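/- Let $A\in\mathbb R^{n\times n}$, $B\in\mathbb R^{n\times m}$, let $Q,R,W$ be symmetric positive definite, and consider $$x_{k+1}=Ax_k+Bu_k+w_k,\qquad x_0=0,\qquad w_k \text{ i.i.d. } \mathcal N(0,W),$$ with cost $J=\limsup_{T\to\infty}\frac1T\,\mathbb E\big[\sum_{k=0}^{T-1}x_k^TQx_k+u_k^TRu_k\big]$. Let $K_0\ne K_1$ in $\mathbb R^{m\times n}$ be fixed stabilizing gains, i.e. the spectral radii of $A+BK_0$ and $A+BK_1$ are less than $1$. Let $J^{K_1}$ be the cost of $u_k=K_1x_k$. For $M\in\mathbb R$ and $t\in\mathbb N$ let $J^{K_1,M,t}$ be the cost of the switched controller with counter $\xi_0=0$: at each step, if $\xi_k>0$ then $u_k=K_0x_k$; if $\xi_k=0$ and $\|(K_1-K_0)x_k\|\ge M$ then $\xi_k$ is reset to $t$ and $u_k=K_0x_k$; otherwise $u_k=K_1x_k$; and then $\xi_{k+1}=\max\{\xi_k-1,0\}$. Let $0<\rho<1$ and $P\succ0$ be any fixed pair with $(A+BK_1)^TP(A+BK_1)\prec\rho P$ (for the same $\rho,P$ one then has $((A+BK_0)^t)^TP(A+BK_0)^t\prec\rho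 P$ for all large $t$). Let $\tilde W=\sum_{\tau\ge0}(A+BK_0)^\tau W((A+BK_0)^\tau)^T$ and, with $\|\cdot\|$ the spectral norm of matrices, $$c=\frac{(1-\rho^{1/4})^2}{16\,\|\tilde W\|\,\|P\|\,\|P^{-1}\|\,\|K_1-K_0\|^2}.$$ Then $J^{K_1}<\infty$, and as $M\to\infty$, $t\to\infty$ with $t^{1/4}\exp(-cM^2)\to0$, the cost $J^{K_1,M,t}$ is eventually finite and $$J^{K_1,M,t}-J^{K_1}=O\big(t^{1/4}\exp(-cM^2)\big).$$ Hence the performance loss decays super-exponentially in $M$: if $t=t(M)\to\infty$ and $\log t(M)=o(M^2)$ as $M\to\infty$, then $J^{K_1,M,t(M)}-J^{K_1}=o(e^{-bM})$ for every $b\in\mathbb R$. -/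

import Mathlib

open MeasureTheory ProbabilityTheory Filter Asymptotics Topology
open scoped ENNReal Matrix

namespace SwitchedLQR

/-- `ℝⁿ` with the Euclidean norm. -/
abbrev Vec (n : ℕ) : Type := EuclideanSpace ℝ (Fin n)

/-- The matrix-vector product `A v`, for vectors with the Euclidean norm. -/
noncomputable def act {m n : ℕ} (A : Matrix (Fin m) (Fin n) ℝ) (v : Vec n) : Vec m :=
  Matrix.toEuclideanLin A v

/-- The quadratic form `vᵀ S v`. -/
noncomputable def quadForm {n : ℕ} (S : Matrix (Fin n) (Fin n) ℝ) (v : Vec n) : ℝ :=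
  v.ofLp ⬝ᵥ (S *ᵥ v.ofLp)

/-- The induced 2-norm of a matrix, i.e. its largest singular value. -/
noncomputable def specNorm {m n : ℕ} (A : Matrix (Fin m) (Fin n) ℝ) : ℝ :=
  ‖(Matrix.toEuclideanLin A).toContinuousLinearMap‖

/-- `A` is (Schur) stable: its spectral radius, computed from the complex eigenvalues, is `< 1`. -/
def IsStable {n : ℕ} (A : Matrix (Fin n) (Fin n) ℝ) : Prop :=
  spectralRadius ℂ (A.map Complex.ofReal) < 1

/-- The strict Loewner order `S ≺ S'` on real symmetric matrices. -/
def LoewnerLT {n : ℕ} (S S' : Matrix (Fin n) (Fin n) ℝ) : Prop :=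
  (S' - S).PosDef

/-- A state-feedback controller with internal memory of type `σ`: from the current state and
the current memory it computes the control input and the next memory. -/
abbrev Controller (n m : ℕ) (σ : Type) : Type := Vec n → σ → Vec m × σ

/-- The linear feedback `u = K x` (no memory). -/
noncomputable def linearController {n m : ℕ} (K : Matrix (Fin m) (Fin n) ℝ) :
    Controller n m Unit :=
  fun x _ => (act K x, ())

/-- The switched controller with primary gain `K₁`, fallback gain `K₀`, threshold `M` and dwell
time `t`. The memory is the counter `ξ`. While `ξ > 0` the fallback gain is used; if `ξ = 0` and
`‖(K₁ - K₀) x‖ ≥ M`, the counter is set to `t` and the fallback gain is used; otherwise the primary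
gain is used. In every case the counter is then decreased by one, but not below zero (this is the
truncated subtraction of `ℕ`). -/
noncomputable def switchedController {n m : ℕ} (K₁ K₀ : Matrix (Fin m) (Fin n) ℝ)
    (M : ℝ) (t : ℕ) : Controller n m ℕ :=
  fun x ξ =>
    if 0 < ξ then (act K₀ x, ξ - 1)
    else if M ≤ ‖act (K₁ - K₀) x‖ then (act K₀ x, t - 1)
    else (act K₁ x, 0)

/-- The pair (state, controller memory) at each time for `x_{k+1} = A x_k + B u_k + w_k`, `x_0 = 0`,
with the noise sequence `w` and the initial memory `s₀`. -/
noncomputable def closedLoop {n m : ℕ} {σ : Type} (A : Matrix (Fin n) (Fin n) ℝ)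
    (B : Matrix (Fin n) (Fin m) ℝ) (ctrl : Controller n m σ) (s₀ : σ) (w : ℕ → Vec n) :
    ℕ → Vec n × σ
  | 0 => (0, s₀)
  | k + 1 =>
    let p := closedLoop A B ctrl s₀ w k
    (act A p.1 + act B (ctrl p.1 p.2).1 + w k, (ctrl p.1 p.2).2)

/-- The stage cost `x_kᵀ Q x_k + u_kᵀ R u_k` of the closed loop at time `k`. -/
noncomputable def stageCost {n m : ℕ} {σ : Type} (A : Matrix (Fin n) (Fin n) ℝ)
    (B : Matrix (Fin n) (Fin m) ℝ) (Q : Matrix (Fin n) (Fin n) ℝ) (R : Matrix (Fin m) (Fin m) ℝ)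
    (ctrl : Controller n m σ) (s₀ : σ) (w : ℕ → Vec n) (k : ℕ) : ℝ :=
  quadForm Q (closedLoop A B ctrl s₀ w k).1 +
    quadForm R (ctrl (closedLoop A B ctrl s₀ w k).1 (closedLoop A B ctrl s₀ w k).2).1

/-- The infinite-horizon quadratic cost
`limsup_{T → ∞} (1 / T) 𝔼 [∑_{k < T} (x_kᵀ Q x_k + u_kᵀ R u_k)]`, as an element of `[0, ∞]`
(the stage costs are nonnegative for positive definite `Q` and `R`). -/
noncomputable def lqCost {Ω : Type*} [MeasurableSpace Ω] (μ : Measure Ω) {n m : ℕ} {σ : Type}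
    (A : Matrix (Fin n) (Fin n) ℝ) (B : Matrix (Fin n) (Fin m) ℝ)
    (Q : Matrix (Fin n) (Fin n) ℝ) (R : Matrix (Fin m) (Fin m) ℝ)
    (ctrl : Controller n m σ) (s₀ : σ) (w : ℕ → Ω → Vec n) : ℝ≥0∞ :=
  limsup (fun T : ℕ =>
    (∫⁻ ω, ENNReal.ofReal
      (∑ k ∈ Finset.range T, stageCost A B Q R ctrl s₀ (fun i => w i ω) k) ∂μ) / (T : ℝ≥0∞)) atTop

/-- The cost `J^{K}` of the linear feedback `u = K x`. -/
noncomputable def linearCost {Ω : Type*} [MeasurableSpace Ω] (μ : Measure Ω) {n m : ℕ}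
    (A : Matrix (Fin n) (Fin n) ℝ) (B : Matrix (Fin n) (Fin m) ℝ)
    (Q : Matrix (Fin n) (Fin n) ℝ) (R : Matrix (Fin m) (Fin m) ℝ)
    (K : Matrix (Fin m) (Fin n) ℝ) (w : ℕ → Ω → Vec n) : ℝ≥0∞ :=
  lqCost μ A B Q R (linearController K) () w

/-- The cost `J^{K₁,M,t}` of the switched controller, with the counter starting at zero. -/
noncomputable def switchedCost {Ω : Type*} [MeasurableSpace Ω] (μ : Measure Ω) {n m : ℕ}
    (A : Matrix (Fin n) (Fin n) ℝ) (B : Matrix (Fin n) (Fin m) ℝ)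
    (Q : Matrix (Fin n) (Fin n) ℝ) (R : Matrix (Fin m) (Fin m) ℝ)
    (K₁ K₀ : Matrix (Fin m) (Fin n) ℝ) (M : ℝ) (t : ℕ) (w : ℕ → Ω → Vec n) : ℝ≥0∞ :=
  lqCost μ A B Q R (switchedController K₁ K₀ M t) 0 w

/-- The performance loss `J^{K₁,M,t} - J^{K₁}` as a real number (meaningful when both costs are
finite). -/
noncomputable def costGap {Ω : Type*} [MeasurableSpace Ω] (μ : Measure Ω) {n m : ℕ}
    (A : Matrix (Fin n) (Fin n) ℝ) (B : Matrix (Fin n) (Fin m) ℝ)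
    (Q : Matrix (Fin n) (Fin n) ℝ) (R : Matrix (Fin m) (Fin m) ℝ)
    (K₁ K₀ : Matrix (Fin m) (Fin n) ℝ) (M : ℝ) (t : ℕ) (w : ℕ → Ω → Vec n) : ℝ :=
  (switchedCost μ A B Q R K₁ K₀ M t w).toReal - (linearCost μ A B Q R K₁ w).toReal

/-- `W̃ = ∑_{τ ≥ 0} F^τ W (F^τ)ᵀ`, with `F` the closed-loop matrix of the fallback gain. -/
noncomputable def noiseGramian {n : ℕ} (F W : Matrix (Fin n) (Fin n) ℝ) :
    Matrix (Fin n) (Fin n) ℝ :=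
  ∑' τ : ℕ, F ^ τ * W * (F ^ τ)ᵀ

/-- The constant `c = (1 - ρ^{1/4})² / (16 ‖W̃‖ ‖P‖ ‖P⁻¹‖ ‖K₁ - K₀‖²)`. -/
noncomputable def decayConst {n m : ℕ} (A : Matrix (Fin n) (Fin n) ℝ)
    (B : Matrix (Fin n) (Fin m) ℝ) (W : Matrix (Fin n) (Fin n) ℝ)
    (K₁ K₀ : Matrix (Fin m) (Fin n) ℝ) (ρ : ℝ) (P : Matrix (Fin n) (Fin n) ℝ) : ℝ :=
  (1 - ρ ^ (1 / 4 : ℝ)) ^ 2 /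
    (16 * specNorm (noiseGramian (A + B * K₀) W) * specNorm P * specNorm P⁻¹ *
      specNorm (K₁ - K₀) ^ 2)

/-- The rate `t^{1/4} exp(-c M²)`. -/
noncomputable def gapRate (c M : ℝ) (t : ℕ) : ℝ :=
  (t : ℝ) ^ (1 / 4 : ℝ) * Real.exp (-c * M ^ 2)

/-- The limit regime `M → ∞`, `t → ∞`, `t^{1/4} exp(-c M²) → 0`, as a filter on pairs `(M, t)`. -/
noncomputable def gapRegime (c : ℝ) : Filter (ℝ × ℕ) :=
  (atTop ×ˢ atTop) ⊓ comap (fun p : ℝ × ℕ => gapRate c p.1 p.2) (𝓝 0)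

end SwitchedLQR

/-! Factor `P = Lᵀ * L` and measure states by `‖L x‖`. In this norm the primary loop contracts by `q
= √ρ`, and so does a block of `t` fallback steps once `t` is large. Sample the switched loop at the
times when the counter is zero. Consecutive samples are linked by one of these two contractions plus
the noise accumulated in between. That noise is sub-Gaussian with covariance at most `W̃`, whatever
the length of the block, so a suitable exponential of its squared norm has a uniformly bounded mean
(`integrable_exp_mul_norm_sq`).

By convexity, `exp (c (1 - q)² ‖L x‖²)` contracts in the same way (`exp_sq_contract`). The sampling
times are random, so it is dominated pathwise by a deterministic-time recursion of ratio `q ^ (1 /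
t)`, which pays for one primary step and for a whole block alike (`exp_le_linRec`). The mean of this
majorant is `O(t)`.

A fallback step is preceded, fewer than `t` steps earlier, by a trigger at which `‖L x‖ ≥ s`, with
`s` proportional to `M`. An exponential Markov estimate and a union bound over the delay give `O(t²
exp (-a s²)) = O(δ²)` for the mean squared state on fallback steps (`fallbackSq_le`), where `δ = t
exp (-a s² / 2)`. The difference from the purely linear loop is driven by these steps alone, so its
second moment is also `O(δ²)`. A weighted Young inequality then bounds the gap in expected stage
cost by `O(δ)` (`exists_stageCost_gap_majorant`). The constants make `δ` the fourth power of
`t^{1/4} exp (-c M²)`, so the stated rate follows as soon as that quantity is at most one. -/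

namespace SwitchedLQR

/-! ### Matrix actions, quadratic forms and the factor of `P`. -/

section LinearAlgebra

variable {l m n : ℕ}

lemma act_eq_toLp (A : Matrix (Fin m) (Fin n) ℝ) (v : Vec n) :
    act A v = WithLp.toLp 2 (A *ᵥ v.ofLp) := rfl

lemma act_add (A : Matrix (Fin m) (Fin n) ℝ) (u v : Vec n) : act A (u + v) = act A u + act A v :=
  map_add _ _ _

lemma act_sub (A : Matrix (Fin m) (Fin n) ℝ) (u v : Vec n) : act A (u - v) = act A u - act A v :=
  map_sub _ _ _

lemma act_zero (A : Matrix (Fin m) (Fin n) ℝ) : act A (0 : Vec n) = 0 := map_zero _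

lemma add_act (A B : Matrix (Fin m) (Fin n) ℝ) (v : Vec n) : act (A + B) v = act A v + act B v := by
  simp [act_eq_toLp, Matrix.add_mulVec]

lemma sub_act (A B : Matrix (Fin m) (Fin n) ℝ) (v : Vec n) : act (A - B) v = act A v - act B v := by
  simp [act_eq_toLp, Matrix.sub_mulVec]

lemma mul_act (A : Matrix (Fin l) (Fin m) ℝ) (B : Matrix (Fin m) (Fin n) ℝ) (v : Vec n) :
    act (A * B) v = act A (act B v) := by
  simp [act_eq_toLp, Matrix.mulVec_mulVec]

lemma one_act (v : Vec n) : act (1 : Matrix (Fin n) (Fin n) ℝ) v = v := by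
  simp [act_eq_toLp]

lemma continuous_act (A : Matrix (Fin m) (Fin n) ℝ) : Continuous (act A) :=
  (Matrix.toEuclideanLin A).toContinuousLinearMap.continuous

lemma measurable_act (A : Matrix (Fin m) (Fin n) ℝ) : Measurable (act A) :=
  (continuous_act A).measurable

lemma specNorm_nonneg (A : Matrix (Fin m) (Fin n) ℝ) : 0 ≤ specNorm A := norm_nonneg _

lemma norm_act_le (A : Matrix (Fin m) (Fin n) ℝ) (v : Vec n) : ‖act A v‖ ≤ specNorm A * ‖v‖ :=
  (Matrix.toEuclideanLin A).toContinuousLinearMap.le_opNorm v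

lemma specNorm_le_of_forall {A : Matrix (Fin m) (Fin n) ℝ} {C : ℝ} (hC : 0 ≤ C)
    (h : ∀ v, ‖act A v‖ ≤ C * ‖v‖) : specNorm A ≤ C :=
  ContinuousLinearMap.opNorm_le_bound _ hC h

lemma specNorm_pos {A : Matrix (Fin m) (Fin n) ℝ} (hA : A ≠ 0) : 0 < specNorm A := by
  refine norm_pos_iff.2 fun h => hA ?_
  have h1 : Matrix.toEuclideanLin A = 0 := by simpa using h
  simpa using h1

lemma inner_eq_dotProduct (u v : Vec n) : inner ℝ u v = u.ofLp ⬝ᵥ v.ofLp := by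
  rw [EuclideanSpace.inner_eq_star_dotProduct, dotProduct_comm]
  simp

lemma quadForm_eq_inner (S : Matrix (Fin n) (Fin n) ℝ) (v : Vec n) :
    quadForm S v = inner ℝ v (act S v) := by
  rw [inner_eq_dotProduct]; rfl

lemma inner_act_left (A : Matrix (Fin m) (Fin n) ℝ) (u : Vec n) (v : Vec m) :
    inner ℝ (act A u) v = inner ℝ u (act Aᵀ v) := by
  rw [inner_eq_dotProduct, inner_eq_dotProduct]
  simp only [act_eq_toLp]
  rw [Matrix.mulVec_transpose, dotProduct_comm, Matrix.dotProduct_mulVec, dotProduct_comm]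

lemma inner_act_right (A : Matrix (Fin m) (Fin n) ℝ) (u : Vec m) (v : Vec n) :
    inner ℝ u (act A v) = inner ℝ (act Aᵀ u) v := by
  rw [inner_act_left, Matrix.transpose_transpose]

lemma quadForm_le (S : Matrix (Fin n) (Fin n) ℝ) (v : Vec n) :
    quadForm S v ≤ specNorm S * ‖v‖ ^ 2 := by
  rw [quadForm_eq_inner]
  calc _ ≤ ‖v‖ * ‖act S v‖ := real_inner_le_norm _ _
    _ ≤ ‖v‖ * (specNorm S * ‖v‖) := by gcongr; exact norm_act_le _ _
    _ = _ := by ring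

lemma abs_quadForm_sub_le (S : Matrix (Fin n) (Fin n) ℝ) (u v : Vec n) :
    |quadForm S u - quadForm S v| ≤ specNorm S * (‖u - v‖ * (‖u‖ + ‖v‖)) := by
  have h : quadForm S u - quadForm S v = inner ℝ u (act S (u - v)) + inner ℝ (u - v) (act S v) := by
    simp only [quadForm_eq_inner, act_sub, inner_sub_left, inner_sub_right]; ring
  rw [h]
  calc _ ≤ ‖u‖ * ‖act S (u - v)‖ + ‖u - v‖ * ‖act S v‖ :=
        (abs_add_le _ _).trans (add_le_add (abs_real_inner_le_norm _ _) (abs_real_inner_le_norm _ _))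
    _ ≤ ‖u‖ * (specNorm S * ‖u - v‖) + ‖u - v‖ * (specNorm S * ‖v‖) := by
        gcongr <;> exact norm_act_le _ _
    _ = _ := by ring

lemma quadForm_nonneg {S : Matrix (Fin n) (Fin n) ℝ} (hS : S.PosSemidef) (v : Vec n) :
    0 ≤ quadForm S v := by
  have h := hS.dotProduct_mulVec_nonneg v.ofLp
  simp only [star_trivial] at h
  exact h

lemma quadForm_transpose_mul (L : Matrix (Fin m) (Fin n) ℝ) (v : Vec n) :
    quadForm (Lᵀ * L) v = ‖act L v‖ ^ 2 := by
  rw [quadForm_eq_inner, mul_act, ← inner_act_left, real_inner_self_eq_norm_sq]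

lemma quadForm_conj (S : Matrix (Fin n) (Fin n) ℝ) (F : Matrix (Fin n) (Fin m) ℝ) (v : Vec m) :
    quadForm (Fᵀ * S * F) v = quadForm S (act F v) := by
  rw [quadForm_eq_inner, mul_act, mul_act, ← inner_act_left, quadForm_eq_inner]

lemma quadForm_le_of_loewnerLT {S T : Matrix (Fin n) (Fin n) ℝ} (h : LoewnerLT S T) (v : Vec n) :
    quadForm S v ≤ quadForm T v := by
  have := quadForm_nonneg h.posSemidef v
  simp only [quadForm_eq_inner, sub_act, inner_sub_right] at this ⊢
  linarith

open scoped MatrixOrder in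
lemma exists_transpose_mul_self {P : Matrix (Fin n) (Fin n) ℝ} (hP : P.PosDef) :
    ∃ L : Matrix (Fin n) (Fin n) ℝ, P = Lᵀ * L ∧ IsUnit L := by
  have h0 : 0 ≤ P := hP.posSemidef.nonneg
  obtain ⟨L, hL⟩ := CStarAlgebra.nonneg_iff_eq_star_mul_self.1 h0
  refine ⟨L, by simpa [Matrix.star_eq_conjTranspose] using hL, ?_⟩
  have := hP.isUnit
  rw [hL] at this
  rw [Matrix.isUnit_iff_isUnit_det] at this ⊢
  rw [Matrix.det_mul] at this
  exact isUnit_of_mul_isUnit_right this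

lemma norm_act_factor_sq_le {P L : Matrix (Fin n) (Fin n) ℝ} (h : P = Lᵀ * L) (v : Vec n) :
    ‖act L v‖ ^ 2 ≤ specNorm P * ‖v‖ ^ 2 := by
  rw [← quadForm_transpose_mul, ← h]; exact quadForm_le _ _

/-- Cauchy–Schwarz applied to `‖v‖² = ⟪L v, L⁻ᵀ v⟫`. Since `L⁻ᵀ` is a factor of `P⁻¹`, the upper
bound for factors controls the second vector. -/
lemma norm_sq_le_norm_act_factor {P L : Matrix (Fin n) (Fin n) ℝ} (h : P = Lᵀ * L)
    (hL : IsUnit L) (v : Vec n) : ‖v‖ ^ 2 ≤ specNorm P⁻¹ * ‖act L v‖ ^ 2 := by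
  have hdet := (Matrix.isUnit_iff_isUnit_det _).1 hL
  have hinv : P⁻¹ = (L⁻¹ᵀ)ᵀ * L⁻¹ᵀ := by
    rw [h, Matrix.mul_inv_rev, Matrix.transpose_transpose, Matrix.transpose_nonsing_inv]
  have h1 : ‖v‖ ^ 2 ≤ ‖act L v‖ * ‖act L⁻¹ᵀ v‖ := by
    calc ‖v‖ ^ 2 = inner ℝ (act L v) (act L⁻¹ᵀ v) := by
          rw [inner_act_left, ← mul_act, ← Matrix.transpose_mul, Matrix.nonsing_inv_mul _ hdet,
            Matrix.transpose_one, one_act, real_inner_self_eq_norm_sq]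
      _ ≤ _ := real_inner_le_norm _ _
  have h2 : ‖act L⁻¹ᵀ v‖ ^ 2 ≤ specNorm P⁻¹ * ‖v‖ ^ 2 := norm_act_factor_sq_le hinv v
  rcases (norm_nonneg v).eq_or_lt with h0 | h0
  · rw [← h0]; have := specNorm_nonneg P⁻¹; simp; positivity
  · have h3 : (‖v‖ ^ 2) ^ 2 ≤ ‖act L v‖ ^ 2 * (specNorm P⁻¹ * ‖v‖ ^ 2) := by
      calc _ ≤ (‖act L v‖ * ‖act L⁻¹ᵀ v‖) ^ 2 := by gcongr
        _ = ‖act L v‖ ^ 2 * ‖act L⁻¹ᵀ v‖ ^ 2 := by ring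
        _ ≤ _ := by gcongr
    have h4 : 0 < ‖v‖ ^ 2 := by positivity
    nlinarith

end LinearAlgebra

/-! ### From spectral radius to geometric decay of powers. -/

section Stability

variable {n : ℕ}

open scoped Matrix.Norms.L2Operator in
lemma specNorm_le_norm_map_ofReal (X : Matrix (Fin n) (Fin n) ℝ) :
    specNorm X ≤ ‖X.map Complex.ofReal‖ := by
  refine specNorm_le_of_forall (norm_nonneg _) fun v => ?_
  set vc : EuclideanSpace ℂ (Fin n) := WithLp.toLp 2 fun i => (v i : ℂ) with hvc
  have h := Matrix.l2_opNorm_mulVec (X.map Complex.ofReal) vc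
  have h1 : ‖vc‖ = ‖v‖ := by simp [EuclideanSpace.norm_eq, hvc]
  have h2 : ‖(WithLp.toLp 2 ((X.map Complex.ofReal) *ᵥ vc.ofLp) : EuclideanSpace ℂ (Fin n))‖
      = ‖act X v‖ := by
    rw [EuclideanSpace.norm_eq, EuclideanSpace.norm_eq]
    congr 1
    refine Finset.sum_congr rfl fun i _ => ?_
    congr 1
    rw [← Complex.norm_real]
    congr 1
    simp [act_eq_toLp, Matrix.mulVec, dotProduct, hvc]
  rw [← h1, ← h2]
  exact h

open scoped Matrix.Norms.L2Operator in
-- Gelfand's formula gives the decay for large exponents; the finitely many others are absorbed into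
-- the constant.
lemma IsStable.exists_specNorm_pow_le {F : Matrix (Fin n) (Fin n) ℝ} (hF : IsStable F) :
    ∃ C r : ℝ, 0 ≤ C ∧ 0 ≤ r ∧ r < 1 ∧ ∀ k, specNorm (F ^ k) ≤ C * r ^ k := by
  obtain ⟨r, hr, hr1⟩ := ENNReal.lt_iff_exists_nnreal_btwn.1 hF
  have hr1' : r < 1 := by exact_mod_cast hr1
  have hlim := spectrum.pow_nnnorm_pow_one_div_tendsto_nhds_spectralRadius (F.map Complex.ofReal)
  have hev := (hlim.eventually_lt_const hr).and (eventually_ge_atTop 1)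
  obtain ⟨N, hN⟩ := eventually_atTop.1 hev
  have hpow : ∀ k, N ≤ k → specNorm (F ^ k) ≤ (r : ℝ) ^ k := by
    intro k hk
    obtain ⟨h1, h2⟩ := hN k hk
    have hk0 : (0 : ℝ) < k := by exact_mod_cast h2
    have h3 : (‖(F.map Complex.ofReal) ^ k‖₊ : ℝ≥0∞) ≤ (r : ℝ≥0∞) ^ k := by
      have := ENNReal.rpow_le_rpow h1.le hk0.le
      rwa [← ENNReal.rpow_mul, one_div, inv_mul_cancel₀ hk0.ne', ENNReal.rpow_one,
        ENNReal.rpow_natCast] at this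
    have h4 : ‖(F.map Complex.ofReal) ^ k‖₊ ≤ r ^ k := by exact_mod_cast h3
    have h5 : ‖(F.map Complex.ofReal) ^ k‖ ≤ (r : ℝ) ^ k := by exact_mod_cast h4
    refine (specNorm_le_norm_map_ofReal _).trans (le_of_eq_of_le ?_ h5)
    congr 1
    exact map_pow (Complex.ofRealHom.mapMatrix (m := Fin n)) F k
  -- The ratio found above may be zero; a positive one is needed to divide by its powers.
  set ρ : ℝ := max r (1 / 2) with hρ
  have hρ0 : 0 < ρ := lt_of_lt_of_le (by norm_num) (le_max_right _ _)
  have hS : ∀ k, 0 ≤ specNorm (F ^ k) / ρ ^ k := fun k => by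
    have := specNorm_nonneg (F ^ k); positivity
  refine ⟨1 + ∑ k ∈ Finset.range N, specNorm (F ^ k) / ρ ^ k, ρ,
    add_nonneg zero_le_one (Finset.sum_nonneg fun k _ => hS k), hρ0.le,
    max_lt (by exact_mod_cast hr1') (by norm_num), fun k => ?_⟩
  rcases lt_or_ge k N with hk | hk
  · rw [← div_le_iff₀ (by positivity)]
    have := Finset.single_le_sum (fun k _ => hS k) (Finset.mem_range.2 hk)
    linarith
  · calc specNorm (F ^ k) ≤ (r : ℝ) ^ k := hpow k hk
      _ ≤ 1 * ρ ^ k := by rw [one_mul]; gcongr; exact le_max_left _ _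
      _ ≤ _ := by
        gcongr
        exact le_add_of_nonneg_right (Finset.sum_nonneg fun k _ => hS k)

end Stability

/-! ### Convergence of the noise Gramian, and its domination of partial sums. -/

section Gramian

variable {m n : ℕ}

lemma norm_act_transpose_le (A : Matrix (Fin m) (Fin n) ℝ) (v : Vec m) :
    ‖act Aᵀ v‖ ≤ specNorm A * ‖v‖ := by
  rcases (norm_nonneg (act Aᵀ v)).eq_or_lt with h0 | h0
  · rw [← h0]; have := specNorm_nonneg A; positivity
  · have h : ‖act Aᵀ v‖ ^ 2 ≤ specNorm A * ‖act Aᵀ v‖ * ‖v‖ := by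
      calc ‖act Aᵀ v‖ ^ 2 = inner ℝ (act A (act Aᵀ v)) v := by
            rw [inner_act_left, real_inner_self_eq_norm_sq]
        _ ≤ ‖act A (act Aᵀ v)‖ * ‖v‖ := real_inner_le_norm _ _
        _ ≤ _ := by gcongr; exact norm_act_le _ _
    nlinarith

lemma entry_eq_inner (X : Matrix (Fin n) (Fin n) ℝ) (i j : Fin n) :
    X i j = inner ℝ (EuclideanSpace.single i (1 : ℝ)) (act X (EuclideanSpace.single j 1)) := by
  simp [act_eq_toLp, EuclideanSpace.inner_single_left]

lemma summable_noiseGramian {F : Matrix (Fin n) (Fin n) ℝ} (hF : IsStable F)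
    (W : Matrix (Fin n) (Fin n) ℝ) : Summable fun τ : ℕ => F ^ τ * W * (F ^ τ)ᵀ := by
  obtain ⟨C, r, hC, hr, hr1, hb⟩ := hF.exists_specNorm_pow_le
  refine Pi.summable.2 fun i => Pi.summable.2 fun j => ?_
  have hg : Summable fun τ : ℕ => (C ^ 2 * specNorm W) * (r ^ 2) ^ τ :=
    (summable_geometric_of_lt_one (by positivity) (by nlinarith)).mul_left _
  refine Summable.of_norm_bounded hg fun τ => ?_
  have hW := specNorm_nonneg W
  have hu : ∀ k : Fin n, ‖act (F ^ τ)ᵀ (EuclideanSpace.single k (1 : ℝ))‖ ≤ C * r ^ τ := fun k =>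
    (norm_act_transpose_le _ _).trans (by simpa using hb τ)
  have he := entry_eq_inner (F ^ τ * W * (F ^ τ)ᵀ) i j
  rw [mul_act, mul_act, inner_act_right] at he
  refine (congrArg norm he).trans_le ?_
  calc _ ≤ ‖act (F ^ τ)ᵀ (EuclideanSpace.single i (1 : ℝ))‖ *
        ‖act W (act (F ^ τ)ᵀ (EuclideanSpace.single j (1 : ℝ)))‖ := norm_inner_le_norm _ _
    _ ≤ (C * r ^ τ) * (specNorm W * (C * r ^ τ)) := by
        gcongr
        · exact hu i
        · exact (norm_act_le _ _).trans (by gcongr; exact hu j)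
    _ = _ := by ring

/-- Evaluating the form at `u` is continuous and additive in the matrix, so it passes through the
series, whose terms become nonnegative. -/
lemma sum_quadForm_le_noiseGramian {F W : Matrix (Fin n) (Fin n) ℝ} (hF : IsStable F)
    (hW : W.PosSemidef) (s : Finset ℕ) (u : Vec n) :
    ∑ τ ∈ s, quadForm W (act (F ^ τ)ᵀ u) ≤ quadForm (noiseGramian F W) u := by
  let φ : Matrix (Fin n) (Fin n) ℝ →+ ℝ :=
    { toFun := fun S => quadForm S u
      map_zero' := by simp [quadForm]
      map_add' := fun S T => by simp [quadForm, Matrix.add_mulVec] }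
  have hφ : Continuous φ := by
    change Continuous fun S : Matrix (Fin n) (Fin n) ℝ => u.ofLp ⬝ᵥ (S *ᵥ u.ofLp)
    fun_prop
  have h := (summable_noiseGramian hF W).hasSum.map φ hφ
  have h2 : ∀ τ, (φ ∘ fun τ : ℕ => F ^ τ * W * (F ^ τ)ᵀ) τ = quadForm W (act (F ^ τ)ᵀ u) := by
    intro τ
    change quadForm _ u = _
    rw [← quadForm_conj, Matrix.transpose_transpose]
  have h3 := sum_le_hasSum s (fun τ _ => by rw [h2]; exact quadForm_nonneg hW _) h
  simp only [h2] at h3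
  exact h3

lemma specNorm_noiseGramian_pos {F W : Matrix (Fin n) (Fin n) ℝ} (hF : IsStable F)
    (hW : W.PosDef) (hn : 0 < n) : 0 < specNorm (noiseGramian F W) := by
  set v : Vec n := EuclideanSpace.single ⟨0, hn⟩ 1 with hv
  have h1 : 0 < quadForm W v := by
    have := hW.dotProduct_mulVec_pos (x := v.ofLp) (by
      intro h; have := congrFun h ⟨0, hn⟩; simp [hv] at this)
    simp only [star_trivial] at this
    exact this
  -- The term `τ = 0` is `W` itself, which already makes the Gramian nonzero.
  have h2 := sum_quadForm_le_noiseGramian hF hW.posSemidef {0} v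
  have h3 := quadForm_le (noiseGramian F W) v
  simp only [Finset.sum_singleton, pow_zero, Matrix.transpose_one, one_act] at h2
  have : ‖v‖ = 1 := by simp [hv]
  rw [this] at h3
  linarith

end Gramian

/-! ### Noise accumulated along a stretch of fallback steps. -/

section FlightNoise

variable {n : ℕ}

/-- The noise accumulated by `x ↦ F x + w` during the `τ` steps that start at time `i`. -/
noncomputable def flightNoise (F : Matrix (Fin n) (Fin n) ℝ) (w : ℕ → Vec n) (i : ℕ) : ℕ → Vec n
  | 0 => 0
  | τ + 1 => act F (flightNoise F w i τ) + w (i + τ)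

/-- Each scalar projection is a sum of functions of distinct noise vectors, which is the form needed
to use independence. -/
lemma inner_flightNoise (F : Matrix (Fin n) (Fin n) ℝ) (w : ℕ → Vec n) (i τ : ℕ) (u : Vec n) :
    inner ℝ u (flightNoise F w i τ) =
      ∑ l ∈ Finset.range τ, inner ℝ (act (F ^ (τ - 1 - l))ᵀ u) (w (i + l)) := by
  induction τ generalizing u with
  | zero => simp [flightNoise]
  | succ τ ih =>
    rw [Finset.sum_range_succ, flightNoise, inner_add_right]
    congr 1
    · rw [inner_act_right, ih]
      refine Finset.sum_congr rfl fun l hl => ?_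
      have hl := Finset.mem_range.1 hl
      rw [show τ + 1 - 1 - l = τ - 1 - l + 1 by omega, pow_succ' F, Matrix.transpose_mul, mul_act]
    · simp [one_act]

variable {Ω : Type*} [MeasurableSpace Ω] {μ : Measure Ω}

lemma aemeasurable_flightNoise (F : Matrix (Fin n) (Fin n) ℝ) {w : ℕ → Ω → Vec n}
    (hw : ∀ k, AEMeasurable (w k) μ) (i τ : ℕ) :
    AEMeasurable (fun ω => flightNoise F (fun k => w k ω) i τ) μ := by
  induction τ with
  | zero => exact aemeasurable_const
  | succ τ ih => exact ((measurable_act F).comp_aemeasurable ih).add (hw _)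

end FlightNoise

/-! ### Sub-Gaussian bounds and exponential moments of squared norms. -/

section Gaussian

variable {n : ℕ} {Ω : Type*} [MeasurableSpace Ω] {μ : Measure Ω}

lemma mgf_inner_of_hasLaw {W : Matrix (Fin n) (Fin n) ℝ} (hW : W.PosSemidef) {X : Ω → Vec n}
    (hX : HasLaw X (multivariateGaussian 0 W) μ) (u : Vec n) :
    mgf (fun ω => inner ℝ u (X ω)) μ 1 = Real.exp (quadForm W u / 2) := by
  have h1 : μ.map (fun ω => inner ℝ u (X ω)) = gaussianReal 0 (quadForm W u).toNNReal := by
    have h2 := IsGaussian.map_eq_gaussianReal (μ := multivariateGaussian 0 W) (innerSL ℝ u)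
    have h3 : ∫ x, (innerSL ℝ u) x ∂(multivariateGaussian 0 W) = 0 := by
      rw [ContinuousLinearMap.integral_comp_id_comm IsGaussian.integrable_id]
      simp
    have h4 : Var[innerSL ℝ u; multivariateGaussian 0 W] = quadForm W u := by
      have := covarianceBilin_self (μ := multivariateGaussian 0 W) IsGaussian.memLp_two_id u
      rw [covarianceBilin_multivariateGaussian hW] at this
      exact this.symm
    rw [h3, h4, ← hX.map_eq, AEMeasurable.map_map_of_aemeasurable (by fun_prop) hX.aemeasurable]
      at h2
    exact h2
  rw [mgf_gaussianReal h1, Real.coe_toNNReal _ (quadForm_nonneg hW u)]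
  congr 1; ring

/-- Independence turns the moment generating function into a product, and the variances add up to a
partial sum of the Gramian. This makes the bound uniform in `τ`. Positivity is recorded because it
encodes integrability of the exponential. -/
lemma mgf_inner_flightNoise_le {F W : Matrix (Fin n) (Fin n) ℝ} (hF : IsStable F)
    (hW : W.PosSemidef) {w : ℕ → Ω → Vec n} (hw_indep : iIndepFun w μ)
    (hw_law : ∀ k, HasLaw (w k) (multivariateGaussian 0 W) μ) (i τ : ℕ) (u : Vec n) :
    0 < mgf (fun ω => inner ℝ u (flightNoise F (fun k => w k ω) i τ)) μ 1 ∧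
    mgf (fun ω => inner ℝ u (flightNoise F (fun k => w k ω) i τ)) μ 1 ≤
      Real.exp (specNorm (noiseGramian F W) * ‖u‖ ^ 2 / 2) := by
  have hi : iIndepFun (fun l => fun ω => inner ℝ (act (F ^ (τ - 1 - l))ᵀ u) (w (i + l) ω)) μ :=
    (hw_indep.precomp (add_right_injective i)).comp
      (fun l x => inner ℝ (act (F ^ (τ - 1 - l))ᵀ u) x) (fun l => by fun_prop)
  have h := hi.mgf_sum₀ (t := 1) (fun l => by
    have := (hw_law (i + l)).aemeasurable
    fun_prop) (Finset.range τ)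
  have he : (fun ω => inner ℝ u (flightNoise F (fun k => w k ω) i τ)) =
      ∑ l ∈ Finset.range τ, fun ω => inner ℝ (act (F ^ (τ - 1 - l))ᵀ u) (w (i + l) ω) := by
    ext ω
    rw [inner_flightNoise, Finset.sum_apply]
  rw [he, h, Finset.prod_congr rfl fun l _ => mgf_inner_of_hasLaw hW (hw_law (i + l)) _,
    ← Real.exp_sum]
  refine ⟨Real.exp_pos _, Real.exp_le_exp.2 ?_⟩
  rw [← Finset.sum_div]
  gcongr
  rw [Finset.sum_range_reflect (fun l => quadForm W (act (F ^ l)ᵀ u))]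
  exact (sum_quadForm_le_noiseGramian hF hW _ _).trans (quadForm_le _ _)

/-- The moment `𝔼 exp (a |g|²)` of a standard normal vector `g`. -/
noncomputable def gaussianSqMoment (n : ℕ) (a : ℝ) : ℝ :=
  ∫ g : Fin n → ℝ, ∏ i, Real.exp (a * g i ^ 2) ∂(Measure.pi fun _ => gaussianReal 0 1)

lemma integrable_exp_mul_sq_gaussianReal {a : ℝ} (ha : a < 1 / 2) :
    Integrable (fun x => Real.exp (a * x ^ 2)) (gaussianReal 0 1) := by
  rw [gaussianReal_of_var_ne_zero 0 one_ne_zero,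
    integrable_withDensity_iff (measurable_gaussianPDF _ _) (ae_of_all _ fun _ => gaussianPDF_lt_top)]
  have h := (integrable_exp_neg_mul_sq (b := 1 / 2 - a) (by linarith)).mul_const (√(2 * Real.pi))⁻¹
  refine h.congr (ae_of_all _ fun x => ?_)
  simp only [toReal_gaussianPDF, gaussianPDFReal]
  rw [mul_comm (Real.exp (a * x ^ 2)), mul_assoc, ← Real.exp_add, mul_comm]
  simp only [NNReal.coe_one, mul_one]
  congr 2
  ring

lemma integrable_gaussianSq {a : ℝ} (ha : a < 1 / 2) :
    Integrable (fun g : Fin n → ℝ => ∏ i, Real.exp (a * g i ^ 2))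
      (Measure.pi fun _ => gaussianReal 0 1) :=
  Integrable.fintype_prod fun _ => integrable_exp_mul_sq_gaussianReal ha

lemma lintegral_exp_linear_gaussian (v : Fin n → ℝ) :
    ∫⁻ g : Fin n → ℝ, ENNReal.ofReal (∏ i, Real.exp (v i * g i))
      ∂(Measure.pi fun _ => gaussianReal 0 1) = ENNReal.ofReal (Real.exp ((∑ i, v i ^ 2) / 2)) := by
  rw [← ofReal_integral_eq_lintegral_ofReal]
  · congr 1
    rw [integral_fintype_prod_eq_prod (f := fun i x => Real.exp (v i * x)), Finset.sum_div,
      Real.exp_sum]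
    refine Finset.prod_congr rfl fun i _ => ?_
    have := congrFun (mgf_id_gaussianReal (μ := 0) (v := 1)) (v i)
    simp only [mgf, id] at this
    rw [this]; congr 1; simp
  · exact Integrable.fintype_prod (f := fun i x => Real.exp (v i * x))
      fun i => integrable_exp_mul_gaussianReal (v i)
  · exact ae_of_all _ fun g => Finset.prod_nonneg fun i _ => (Real.exp_pos _).le

/-- A random vector whose moment generating function is dominated by that of `N(0, b I)` has
`𝔼 exp (κ |X|²)` bounded by the same moment of `N(0, b I)`. -/
lemma integrable_exp_mul_norm_sq [IsProbabilityMeasure μ] {X : Ω → Vec n} (hX : AEMeasurable X μ)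
    {b κ : ℝ} (hκ : 0 ≤ κ) (hκb : κ * b < 1 / 2)
    (hmgf : ∀ u : Vec n, 0 < mgf (fun ω => inner ℝ u (X ω)) μ 1 ∧
      mgf (fun ω => inner ℝ u (X ω)) μ 1 ≤ Real.exp (b * ‖u‖ ^ 2 / 2)) :
    Integrable (fun ω => Real.exp (κ * ‖X ω‖ ^ 2)) μ ∧
      ∫ ω, Real.exp (κ * ‖X ω‖ ^ 2) ∂μ ≤ gaussianSqMoment n (κ * b) := by
  set s := √(2 * κ) with hs
  have hs2 : s ^ 2 = 2 * κ := Real.sq_sqrt (by positivity)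
  have hmeas : AEMeasurable (fun ω => Real.exp (κ * ‖X ω‖ ^ 2)) μ := by fun_prop
  have hle : ∫⁻ ω, ENNReal.ofReal (Real.exp (κ * ‖X ω‖ ^ 2)) ∂μ ≤
      ENNReal.ofReal (gaussianSqMoment n (κ * b)) := by
    -- Linearise the square: `exp (κ |x|²)` is the mean of `exp (√(2κ) ⟪x, g⟫)` over an auxiliary
    -- standard normal `g`. Tonelli then leaves only the moment generating function of `X` to
    -- estimate.
    have h1 : ∀ ω, ENNReal.ofReal (Real.exp (κ * ‖X ω‖ ^ 2)) =
        ∫⁻ g : Fin n → ℝ, ENNReal.ofReal (∏ i, Real.exp (s * X ω i * g i))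
          ∂(Measure.pi fun _ => gaussianReal 0 1) := by
      intro ω
      rw [lintegral_exp_linear_gaussian (fun i => s * X ω i), EuclideanSpace.real_norm_sq_eq]
      congr 2
      simp only [mul_pow, hs2, ← Finset.mul_sum]; ring
    simp_rw [h1]
    rw [lintegral_lintegral_swap (by
      have : ∀ i, AEMeasurable (fun p : Ω × (Fin n → ℝ) => X p.1 i)
          (μ.prod (Measure.pi fun _ => gaussianReal 0 1)) := fun i =>
        (show Measurable fun v : Vec n => v i by fun_prop).comp_aemeasurable hX.comp_fst
      refine ENNReal.measurable_ofReal.comp_aemeasurable (Finset.aemeasurable_fun_prod _ fun i _ => ?_)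
      have := this i
      fun_prop)]
    rw [gaussianSqMoment, ofReal_integral_eq_lintegral_ofReal (integrable_gaussianSq hκb)
      (ae_of_all _ fun g => Finset.prod_nonneg fun i _ => (Real.exp_pos _).le)]
    refine lintegral_mono fun g => ?_
    set u : Vec n := WithLp.toLp 2 fun i => s * g i with hu
    have h2 : ∀ ω, ∏ i, Real.exp (s * X ω i * g i) = Real.exp (1 * inner ℝ u (X ω)) := by
      intro ω
      rw [← Real.exp_sum, inner_eq_dotProduct, one_mul]
      congr 1
      exact Finset.sum_congr rfl fun i _ => by simp [hu]; ring
    simp_rw [h2]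
    rw [← ofReal_integral_eq_lintegral_ofReal (mgf_pos_iff.1 (hmgf u).1)
      (ae_of_all _ fun _ => (Real.exp_pos _).le)]
    refine ENNReal.ofReal_le_ofReal ((hmgf u).2.trans_eq ?_)
    rw [← Real.exp_sum, EuclideanSpace.real_norm_sq_eq]
    congr 1
    simp only [hu, mul_pow, hs2, ← Finset.mul_sum]; ring
  have hC : 0 ≤ gaussianSqMoment n (κ * b) :=
    integral_nonneg fun g => Finset.prod_nonneg fun i _ => (Real.exp_pos _).le
  have hint : Integrable (fun ω => Real.exp (κ * ‖X ω‖ ^ 2)) μ := by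
    refine ⟨hmeas.aestronglyMeasurable, ?_⟩
    rw [hasFiniteIntegral_iff_ofReal (ae_of_all _ fun _ => (Real.exp_pos _).le)]
    exact hle.trans_lt ENNReal.ofReal_lt_top
  refine ⟨hint, ?_⟩
  rw [← ofReal_integral_eq_lintegral_ofReal hint (ae_of_all _ fun _ => (Real.exp_pos _).le)] at hle
  exact (ENNReal.ofReal_le_ofReal_iff hC).1 hle

end Gaussian

/-! ### Scalar recursions, bounds in mean, and convexity inequalities. -/

section ScalarRecursion

/-- The solution of the scalar recursion `g_{k+1} = r g_k + e_k`, `g_0 = a`. -/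
def linRec (r a : ℝ) (e : ℕ → ℝ) : ℕ → ℝ
  | 0 => a
  | k + 1 => r * linRec r a e k + e k

lemma linRec_nonneg {r a : ℝ} {e : ℕ → ℝ} (hr : 0 ≤ r) (ha : 0 ≤ a) (he : ∀ k, 0 ≤ e k) (k : ℕ) :
    0 ≤ linRec r a e k := by
  induction k with
  | zero => exact ha
  | succ k ih => exact add_nonneg (mul_nonneg hr ih) (he k)

/-- Lets the recursion cross a block of `s` steps at the price of the factor `r ^ s`, ignoring the
nonnegative inputs in between. -/
lemma pow_mul_linRec_le {r a : ℝ} {e : ℕ → ℝ} (hr : 0 ≤ r) (he : ∀ k, 0 ≤ e k) (k s : ℕ) :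
    r ^ s * linRec r a e k ≤ linRec r a e (k + s) := by
  induction s with
  | zero => simp
  | succ s ih =>
    have h := mul_le_mul_of_nonneg_left ih hr
    have := he (k + s)
    rw [← add_assoc, linRec, pow_succ']
    linarith

lemma le_linRec {r a : ℝ} {e f : ℕ → ℝ} (hr : 0 ≤ r) (h0 : f 0 ≤ a)
    (h : ∀ k, f (k + 1) ≤ r * f k + e k) (k : ℕ) : f k ≤ linRec r a e k := by
  induction k with
  | zero => exact h0
  | succ k ih =>
    have := mul_le_mul_of_nonneg_left ih hr
    rw [linRec]
    linarith [h k]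

/-- `f` is integrable with mean at most `C`. -/
def MeanLE {Ω : Type*} [MeasurableSpace Ω] (μ : Measure Ω) (f : Ω → ℝ) (C : ℝ) : Prop :=
  Integrable f μ ∧ ∫ ω, f ω ∂μ ≤ C

section MeanLE

variable {Ω : Type*} [MeasurableSpace Ω] {μ : Measure Ω} {f g : Ω → ℝ} {C D : ℝ}

lemma MeanLE.mono (hf : MeanLE μ f C) (h : C ≤ D) : MeanLE μ f D := ⟨hf.1, hf.2.trans h⟩

lemma MeanLE.add (hf : MeanLE μ f C) (hg : MeanLE μ g D) :
    MeanLE μ (fun ω => f ω + g ω) (C + D) :=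
  ⟨hf.1.add hg.1, by rw [integral_add hf.1 hg.1]; exact add_le_add hf.2 hg.2⟩

lemma MeanLE.const_mul {c : ℝ} (hc : 0 ≤ c) (hf : MeanLE μ f C) :
    MeanLE μ (fun ω => c * f ω) (c * C) :=
  ⟨hf.1.const_mul c, by rw [integral_const_mul]; exact mul_le_mul_of_nonneg_left hf.2 hc⟩

lemma MeanLE.sum_range {f : ℕ → Ω → ℝ} (hf : ∀ k, MeanLE μ (f k) C) (t : ℕ) :
    MeanLE μ (fun ω => ∑ k ∈ Finset.range t, f k ω) (t * C) := by
  refine ⟨integrable_finsetSum _ fun k _ => (hf k).1, ?_⟩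
  rw [integral_finsetSum _ fun k _ => (hf k).1]
  refine (Finset.sum_le_sum fun k _ => (hf k).2).trans_eq ?_
  simp

lemma MeanLE.linRec [IsProbabilityMeasure μ]
    {r a : ℝ} (hr : 0 ≤ r) (hr1 : r < 1) (hC : 0 ≤ C) {e : Ω → ℕ → ℝ}
    (he : ∀ k, MeanLE μ (fun ω => e ω k) C) (k : ℕ) (ha : 0 ≤ a) :
    MeanLE μ (fun ω => SwitchedLQR.linRec r a (e ω) k) (a + C / (1 - r)) := by
  induction k with
  | zero =>
    refine ⟨integrable_const _, ?_⟩
    have : 0 ≤ C / (1 - r) := div_nonneg hC (by linarith)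
    simpa [SwitchedLQR.linRec] using this
  | succ k ih =>
    simp only [SwitchedLQR.linRec]
    refine ((ih.const_mul hr).add (he k)).mono ?_
    have h3 : r * (C / (1 - r)) + C = C / (1 - r) := by
      have : 1 - r ≠ 0 := by linarith
      field_simp; ring
    nlinarith

end MeanLE

/-- Convexity of the square at `q a + (1 - q) (b / (1 - q))`. -/
lemma sq_add_le {q a b : ℝ} (hq : q < 1) (hq0 : 0 ≤ q) :
    (q * a + b) ^ 2 ≤ q * a ^ 2 + b ^ 2 / (1 - q) := by
  have h : 0 < 1 - q := by linarith
  have h1 : q * a ^ 2 + b ^ 2 / (1 - q) - (q * a + b) ^ 2 = q * ((1 - q) * a - b) ^ 2 / (1 - q) := by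
    field_simp; ring
  have : 0 ≤ q * ((1 - q) * a - b) ^ 2 / (1 - q) := by positivity
  linarith

/-- Convexity used twice, for the square and for the exponential, with weights `q` and `1 - q`. The
factor `(1 - q)²` compensates the division of `s` by `1 - q`, so that the noise keeps the exponent
`c`. -/
lemma exp_sq_contract {q c z s v : ℝ} (hq0 : 0 ≤ q) (hq : q < 1) (hc : 0 ≤ c) (hv : 0 ≤ v)
    (h : v ≤ q * z + s) :
    Real.exp (c * (1 - q) ^ 2 * v ^ 2) ≤
      q * Real.exp (c * (1 - q) ^ 2 * z ^ 2) + Real.exp (c * s ^ 2) := by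
  have h1 : 0 < 1 - q := by linarith
  have h2 : v ^ 2 ≤ q * z ^ 2 + (1 - q) * (s ^ 2 / (1 - q) ^ 2) := by
    rw [show (1 - q) * (s ^ 2 / (1 - q) ^ 2) = s ^ 2 / (1 - q) by field_simp]
    exact (pow_le_pow_left₀ hv h 2).trans (sq_add_le hq hq0)
  have h3 : c * (1 - q) ^ 2 * v ^ 2 ≤ q * (c * (1 - q) ^ 2 * z ^ 2) + (1 - q) * (c * s ^ 2) := by
    have h4 : 0 ≤ c * (1 - q) ^ 2 := by positivity
    calc _ ≤ c * (1 - q) ^ 2 * (q * z ^ 2 + (1 - q) * (s ^ 2 / (1 - q) ^ 2)) := by gcongr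
      _ = _ := by field_simp
  have hconv := convexOn_exp.2 (Set.mem_univ (c * (1 - q) ^ 2 * z ^ 2)) (Set.mem_univ (c * s ^ 2))
    hq0 h1.le (by ring)
  simp only [smul_eq_mul] at hconv
  have h5 := Real.exp_pos (c * s ^ 2)
  calc _ ≤ _ := Real.exp_le_exp.2 h3
    _ ≤ _ := hconv
    _ ≤ _ := by nlinarith

/-- If `z ≥ s`, quadratic growth in `z` and `σ` is absorbed into exponential weights, with a factor
`exp (-a s²)` to spare. -/
lemma sq_le_exp_tail {κ η a ε z σ s : ℝ} (hκ : 0 ≤ κ) (hη : 0 < η) (ha : 0 ≤ a) (hε : 0 < ε)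
    (hs : 0 ≤ s) (hz : s ≤ z) (hσ : 0 ≤ σ) :
    (κ * z + σ) ^ 2 ≤ (κ + η) ^ 2 / ε * Real.exp (-(a * s ^ 2)) *
      (Real.exp ((a + ε) * z ^ 2) + Real.exp ((a + ε) / η ^ 2 * σ ^ 2)) := by
  -- The larger of the two scaled terms controls both and still exceeds `s`. The margin `ε` absorbs
  -- the quadratic factor, and the part `a` of the exponent yields the tail.
  set y := max z (σ / η) with hy
  have hsy : s ≤ y := hz.trans (le_max_left _ _)
  have hσy : σ ≤ η * y := by
    have : σ / η ≤ y := le_max_right _ _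
    rw [div_le_iff₀ hη] at this; linarith
  have hzy : κ * z ≤ κ * y := mul_le_mul_of_nonneg_left (le_max_left _ _) hκ
  have h1 : (κ * z + σ) ^ 2 ≤ ((κ + η) * y) ^ 2 :=
    pow_le_pow_left₀ (add_nonneg (mul_nonneg hκ (hs.trans hz)) hσ) (by linarith) 2
  have h2 : y ^ 2 ≤ Real.exp (ε * y ^ 2) / ε := by
    rw [le_div_iff₀ hε]
    linarith [Real.add_one_le_exp (ε * y ^ 2)]
  have h3 : Real.exp (ε * y ^ 2) ≤ Real.exp (-(a * s ^ 2)) * Real.exp ((a + ε) * y ^ 2) := by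
    rw [← Real.exp_add]
    refine Real.exp_le_exp.2 ?_
    have := mul_le_mul_of_nonneg_left (pow_le_pow_left₀ hs hsy 2) ha
    linarith
  have h4 : Real.exp ((a + ε) * y ^ 2) ≤
      Real.exp ((a + ε) * z ^ 2) + Real.exp ((a + ε) / η ^ 2 * σ ^ 2) := by
    rcases max_choice z (σ / η) with h | h
    · rw [hy, h]; linarith [Real.exp_pos ((a + ε) / η ^ 2 * σ ^ 2)]
    · rw [hy, h, show (a + ε) * (σ / η) ^ 2 = (a + ε) / η ^ 2 * σ ^ 2 by ring]
      linarith [Real.exp_pos ((a + ε) * z ^ 2)]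
  calc _ ≤ ((κ + η) * y) ^ 2 := h1
    _ = (κ + η) ^ 2 * y ^ 2 := by ring
    _ ≤ (κ + η) ^ 2 * ((Real.exp (-(a * s ^ 2)) *
        (Real.exp ((a + ε) * z ^ 2) + Real.exp ((a + ε) / η ^ 2 * σ ^ 2))) / ε) := by
        gcongr
        refine h2.trans ?_
        gcongr
        exact h3.trans (by gcongr)
    _ = _ := by ring

end ScalarRecursion

/-! ### Paths of the switched loop: triggers, renewals, and the exponential majorant. -/

section Dynamics

variable {n m : ℕ}

/-- The switched closed loop: state and counter at each time. -/
noncomputable def switchedLoop (A : Matrix (Fin n) (Fin n) ℝ) (B : Matrix (Fin n) (Fin m) ℝ)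
    (K₁ K₀ : Matrix (Fin m) (Fin n) ℝ) (M : ℝ) (t : ℕ) (w : ℕ → Vec n) : ℕ → Vec n × ℕ :=
  closedLoop A B (switchedController K₁ K₀ M t) 0 w

/-- The switched controller applies the fallback gain at `p = (x, ξ)`. -/
def UsesFallback (K₁ K₀ : Matrix (Fin m) (Fin n) ℝ) (M : ℝ) (p : Vec n × ℕ) : Prop :=
  0 < p.2 ∨ M ≤ ‖act (K₁ - K₀) p.1‖

variable (A : Matrix (Fin n) (Fin n) ℝ) (B : Matrix (Fin n) (Fin m) ℝ)
  (K₁ K₀ : Matrix (Fin m) (Fin n) ℝ) (M : ℝ) (t : ℕ) (w : ℕ → Vec n)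

open Classical in
lemma switchedController_fst (p : Vec n × ℕ) :
    (switchedController K₁ K₀ M t p.1 p.2).1 =
      if UsesFallback K₁ K₀ M p then act K₀ p.1 else act K₁ p.1 := by
  unfold switchedController UsesFallback
  split_ifs <;> grind

lemma switchedLoop_succ_of_not {k : ℕ}
    (h : ¬ UsesFallback K₁ K₀ M (switchedLoop A B K₁ K₀ M t w k)) :
    switchedLoop A B K₁ K₀ M t w (k + 1) =
      (act (A + B * K₁) (switchedLoop A B K₁ K₀ M t w k).1 + w k, 0) := by
  unfold UsesFallback at h
  push Not at h
  change (_, _) = _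
  rw [← switchedLoop, add_act, mul_act]
  simp [switchedController, h.1.not_gt, h.2.not_ge]

lemma switchedLoop_succ_of_counter_pos {k : ℕ}
    (h : 0 < (switchedLoop A B K₁ K₀ M t w k).2) :
    switchedLoop A B K₁ K₀ M t w (k + 1) =
      (act (A + B * K₀) (switchedLoop A B K₁ K₀ M t w k).1 + w k,
        (switchedLoop A B K₁ K₀ M t w k).2 - 1) := by
  change (_, _) = _
  rw [← switchedLoop, add_act, mul_act]
  simp [switchedController, h]

lemma switchedLoop_succ_of_trigger {k : ℕ}
    (h0 : (switchedLoop A B K₁ K₀ M t w k).2 = 0)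
    (h : M ≤ ‖act (K₁ - K₀) (switchedLoop A B K₁ K₀ M t w k).1‖) :
    switchedLoop A B K₁ K₀ M t w (k + 1) =
      (act (A + B * K₀) (switchedLoop A B K₁ K₀ M t w k).1 + w k, t - 1) := by
  change (_, _) = _
  rw [← switchedLoop, add_act, mul_act]
  simp [switchedController, h0, h]

variable {A B K₁ K₀ M t w}

/-- Before every step that uses the fallback gain, the state is reached from a trigger state by
iterating the fallback loop for `τ < t` steps. -/
lemma exists_trigger_of_usesFallback {k : ℕ}
    (h : UsesFallback K₁ K₀ M (switchedLoop A B K₁ K₀ M t w k)) (ht : 1 ≤ t) :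
    ∃ i τ, i + τ = k ∧ τ < t ∧ (switchedLoop A B K₁ K₀ M t w i).2 = 0 ∧
      M ≤ ‖act (K₁ - K₀) (switchedLoop A B K₁ K₀ M t w i).1‖ ∧
      (switchedLoop A B K₁ K₀ M t w (k + 1)).2 + τ + 1 = t ∧
      (switchedLoop A B K₁ K₀ M t w k).1 =
        act ((A + B * K₀) ^ τ) (switchedLoop A B K₁ K₀ M t w i).1 +
          flightNoise (A + B * K₀) w i τ := by
  induction k with
  | zero =>
    have h0 : (switchedLoop A B K₁ K₀ M t w 0).2 = 0 := rfl
    have h1 : M ≤ ‖act (K₁ - K₀) (switchedLoop A B K₁ K₀ M t w 0).1‖ :=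
      h.resolve_left (by simp [h0])
    refine ⟨0, 0, rfl, ht, h0, h1, ?_, by simp [flightNoise, one_act]⟩
    rw [switchedLoop_succ_of_trigger _ _ _ _ _ _ _ h0 h1]
    simp only; omega
  | succ k ih =>
    rcases Nat.eq_zero_or_pos (switchedLoop A B K₁ K₀ M t w (k + 1)).2 with h0 | h0
    · have h1 : M ≤ ‖act (K₁ - K₀) (switchedLoop A B K₁ K₀ M t w (k + 1)).1‖ :=
        h.resolve_left (by simp [h0])
      refine ⟨k + 1, 0, rfl, ht, h0, h1, ?_, by simp [flightNoise, one_act]⟩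
      rw [switchedLoop_succ_of_trigger _ _ _ _ _ _ _ h0 h1]
      simp only; omega
    · have hk : UsesFallback K₁ K₀ M (switchedLoop A B K₁ K₀ M t w k) := by
        by_contra hk
        rw [switchedLoop_succ_of_not _ _ _ _ _ _ _ hk] at h0
        exact lt_irrefl _ h0
      obtain ⟨i, τ, hi, hτ, hi0, hiM, hc, hx⟩ := ih hk
      refine ⟨i, τ + 1, by omega, by omega, hi0, hiM, ?_, ?_⟩
      · rw [switchedLoop_succ_of_counter_pos _ _ _ _ _ _ _ h0]
        simp only; omega
      · have hstep : (switchedLoop A B K₁ K₀ M t w (k + 1)).1 =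
            act (A + B * K₀) (switchedLoop A B K₁ K₀ M t w k).1 + w k := by
          rcases Nat.eq_zero_or_pos (switchedLoop A B K₁ K₀ M t w k).2 with hk0 | hk0
          · rw [switchedLoop_succ_of_trigger _ _ _ _ _ _ _ hk0 (hk.resolve_left (by simp [hk0]))]
          · rw [switchedLoop_succ_of_counter_pos _ _ _ _ _ _ _ hk0]
        rw [hstep, hx, act_add, ← mul_act, ← pow_succ', add_assoc, flightNoise, hi]

/-- A time with counter zero is reached from an earlier such time, either by one step of the
primary loop or by `t` steps of the fallback loop. -/
lemma exists_renewal {k : ℕ} (ht : 1 ≤ t) (h : (switchedLoop A B K₁ K₀ M t w (k + 1)).2 = 0) :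
    ((switchedLoop A B K₁ K₀ M t w k).2 = 0 ∧ (switchedLoop A B K₁ K₀ M t w (k + 1)).1 =
      act (A + B * K₁) (switchedLoop A B K₁ K₀ M t w k).1 + flightNoise (A + B * K₀) w k 1) ∨
    (∃ i, i + t = k + 1 ∧ (switchedLoop A B K₁ K₀ M t w i).2 = 0 ∧
      (switchedLoop A B K₁ K₀ M t w (k + 1)).1 =
        act ((A + B * K₀) ^ t) (switchedLoop A B K₁ K₀ M t w i).1 +
          flightNoise (A + B * K₀) w i t) := by
  by_cases hk : UsesFallback K₁ K₀ M (switchedLoop A B K₁ K₀ M t w k)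
  · right
    obtain ⟨i, τ, hi, hτ, hi0, -, hc, hx⟩ := exists_trigger_of_usesFallback hk ht
    -- A trigger leaves the counter at `t - 1`, so a zero counter at time `k + 1` means that the
    -- block has run its full length.
    obtain rfl : t = τ + 1 := by omega
    refine ⟨i, by omega, hi0, ?_⟩
    have hstep : (switchedLoop A B K₁ K₀ M (τ + 1) w (k + 1)).1 =
        act (A + B * K₀) (switchedLoop A B K₁ K₀ M (τ + 1) w k).1 + w k := by
      rcases Nat.eq_zero_or_pos (switchedLoop A B K₁ K₀ M (τ + 1) w k).2 with hk0 | hk0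
      · rw [switchedLoop_succ_of_trigger _ _ _ _ _ _ _ hk0 (hk.resolve_left (by simp [hk0]))]
      · rw [switchedLoop_succ_of_counter_pos _ _ _ _ _ _ _ hk0]
    rw [hstep, hx, act_add, ← mul_act, ← pow_succ', add_assoc, flightNoise, hi]
  · left
    refine ⟨?_, ?_⟩
    · unfold UsesFallback at hk; omega
    · rw [switchedLoop_succ_of_not _ _ _ _ _ _ _ hk]
      simp [flightNoise, act_zero]

/-- Along the renewal times (counter zero) the exponential Lyapunov function is dominated by the
solution of a linear recursion driven by the noise. -/
lemma exp_le_linRec {L : Matrix (Fin n) (Fin n) ℝ} {q r c : ℝ} (hq0 : 0 ≤ q) (hq : q < 1)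
    (hr0 : 0 ≤ r) (hqr : q ≤ r) (hqt : q ≤ r ^ t) (hc : 0 ≤ c) (ht : 1 ≤ t)
    (h₁ : ∀ x, ‖act L (act (A + B * K₁) x)‖ ≤ q * ‖act L x‖)
    (h₀ : ∀ x, ‖act L (act ((A + B * K₀) ^ t) x)‖ ≤ q * ‖act L x‖) (k : ℕ)
    (hk : (switchedLoop A B K₁ K₀ M t w k).2 = 0) :
    Real.exp (c * (1 - q) ^ 2 * ‖act L (switchedLoop A B K₁ K₀ M t w k).1‖ ^ 2) ≤
      linRec r 1 (fun j => Real.exp (c * ‖act L (flightNoise (A + B * K₀) w j 1)‖ ^ 2) +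
        Real.exp (c * ‖act L (flightNoise (A + B * K₀) w (j + 1 - t) t)‖ ^ 2)) k := by
  -- Both kinds of noise are charged at every time, so the input does not depend on which renewal
  -- occurs. For `j + 1 < t` the truncated index only adds a harmless positive term.
  set e : ℕ → ℝ := fun j => Real.exp (c * ‖act L (flightNoise (A + B * K₀) w j 1)‖ ^ 2) +
        Real.exp (c * ‖act L (flightNoise (A + B * K₀) w (j + 1 - t) t)‖ ^ 2) with he
  have he0 : ∀ j, 0 ≤ e j := fun j => add_nonneg (Real.exp_pos _).le (Real.exp_pos _).le
  have hG0 := linRec_nonneg (a := 1) hr0 zero_le_one he0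
  induction k using Nat.strong_induction_on with
  | _ k ih =>
    rcases k with _ | k
    · have : (switchedLoop A B K₁ K₀ M t w 0).1 = 0 := rfl
      simp [this, linRec, act_zero]
    rcases exists_renewal ht hk with ⟨hk0, hx⟩ | ⟨i, hi, hi0, hx⟩
    · have hv : ‖act L (switchedLoop A B K₁ K₀ M t w (k + 1)).1‖ ≤
          q * ‖act L (switchedLoop A B K₁ K₀ M t w k).1‖ +
            ‖act L (flightNoise (A + B * K₀) w k 1)‖ := by
        rw [hx, act_add]
        exact (norm_add_le _ _).trans (by gcongr; exact h₁ _)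
      have h := exp_sq_contract hq0 hq hc (norm_nonneg _) hv
      have h2 := mul_le_mul hqr (ih k (by omega) hk0) (Real.exp_pos _).le hr0
      have h3 := Real.exp_pos (c * ‖act L (flightNoise (A + B * K₀) w (k + 1 - t) t)‖ ^ 2)
      rw [linRec]
      simp only [he] at h2 ⊢
      linarith
    · have hv : ‖act L (switchedLoop A B K₁ K₀ M t w (k + 1)).1‖ ≤
          q * ‖act L (switchedLoop A B K₁ K₀ M t w i).1‖ +
            ‖act L (flightNoise (A + B * K₀) w i t)‖ := by
        rw [hx, act_add]
        exact (norm_add_le _ _).trans (by gcongr; exact h₀ _)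
      have h := exp_sq_contract hq0 hq hc (norm_nonneg _) hv
      have h2 := mul_le_mul hqt (ih i (by omega) hi0) (Real.exp_pos _).le (by positivity)
      have h3 := Real.exp_pos (c * ‖act L (flightNoise (A + B * K₀) w k 1)‖ ^ 2)
      -- Carry the bound from the trigger time `i` to `k = i + (t - 1)`; one more step of the
      -- recursion completes the factor `r ^ t ≥ q`.
      have h4 := pow_mul_linRec_le (a := 1) hr0 he0 i (t - 1)
      rw [show i + (t - 1) = k by omega] at h4
      have h5 := mul_le_mul_of_nonneg_left h4 hr0
      rw [← mul_assoc, ← pow_succ', Nat.sub_add_cancel ht] at h5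
      obtain rfl : i = k + 1 - t := by omega
      rw [linRec]
      simp only [he] at h2 h5 ⊢
      linarith

end Dynamics

/-! ### Pathwise comparison with the linear loop driven by the same noise. -/

section CostComparison

variable {n m : ℕ}

/-- The state of the closed loop under the linear feedback `u = K x`. -/
noncomputable def linearLoop (A : Matrix (Fin n) (Fin n) ℝ) (B : Matrix (Fin n) (Fin m) ℝ)
    (K : Matrix (Fin m) (Fin n) ℝ) (w : ℕ → Vec n) (k : ℕ) : Vec n :=
  (closedLoop A B (linearController K) () w k).1

lemma linearLoop_succ (A : Matrix (Fin n) (Fin n) ℝ) (B : Matrix (Fin n) (Fin m) ℝ)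
    (K : Matrix (Fin m) (Fin n) ℝ) (w : ℕ → Vec n) (k : ℕ) :
    linearLoop A B K w (k + 1) = act (A + B * K) (linearLoop A B K w k) + w k := by
  rw [add_act, mul_act]; rfl

open Classical in
/-- The squared norm `|L x|²` of the switched state, where the fallback gain is in use. -/
noncomputable def fallbackSq (A : Matrix (Fin n) (Fin n) ℝ) (B : Matrix (Fin n) (Fin m) ℝ)
    (K₁ K₀ : Matrix (Fin m) (Fin n) ℝ) (M : ℝ) (t : ℕ) (L : Matrix (Fin n) (Fin n) ℝ)
    (w : ℕ → Vec n) (k : ℕ) : ℝ :=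
  if UsesFallback K₁ K₀ M (switchedLoop A B K₁ K₀ M t w k) then
    ‖act L (switchedLoop A B K₁ K₀ M t w k).1‖ ^ 2 else 0

variable {A : Matrix (Fin n) (Fin n) ℝ} {B : Matrix (Fin n) (Fin m) ℝ}
  {K₁ K₀ : Matrix (Fin m) (Fin n) ℝ} {L : Matrix (Fin n) (Fin n) ℝ} {q : ℝ}

lemma linearLoop_sq_le (hq0 : 0 ≤ q) (hq : q < 1)
    (h₁ : ∀ x, ‖act L (act (A + B * K₁) x)‖ ≤ q * ‖act L x‖) (w : ℕ → Vec n) {f : ℕ → ℝ}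
    (hf : ∀ k, ‖act L (w k)‖ ^ 2 ≤ f k) (k : ℕ) :
    ‖act L (linearLoop A B K₁ w k)‖ ^ 2 ≤ linRec q 0 (fun j => (1 - q)⁻¹ * f j) k := by
  refine le_linRec (f := fun k => ‖act L (linearLoop A B K₁ w k)‖ ^ 2) hq0 ?_ (fun k => ?_) k
  · have : linearLoop A B K₁ w 0 = 0 := rfl
    simp [this, act_zero]
  · have hq' : 0 < 1 - q := by linarith
    refine le_trans ?_ (add_le_add_right
      (mul_le_mul_of_nonneg_left (hf k) (inv_nonneg.2 hq'.le)) _)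
    rw [inv_mul_eq_div]
    refine (pow_le_pow_left₀ (norm_nonneg _) ?_ 2).trans (sq_add_le hq hq0)
    rw [linearLoop_succ, act_add]
    exact (norm_add_le _ _).trans (by gcongr; exact h₁ _)

open Classical in
-- The common noise cancels, so the difference is forced only by steps that use the fallback gain.
lemma switchedLoop_sub_linearLoop_succ (M : ℝ) (t : ℕ) (w : ℕ → Vec n) (k : ℕ) :
    (switchedLoop A B K₁ K₀ M t w (k + 1)).1 - linearLoop A B K₁ w (k + 1) =
      act (A + B * K₁) ((switchedLoop A B K₁ K₀ M t w k).1 - linearLoop A B K₁ w k) -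
        if UsesFallback K₁ K₀ M (switchedLoop A B K₁ K₀ M t w k) then
          act (B * (K₁ - K₀)) (switchedLoop A B K₁ K₀ M t w k).1 else 0 := by
  have h : (switchedLoop A B K₁ K₀ M t w (k + 1)).1 =
      act A (switchedLoop A B K₁ K₀ M t w k).1 +
        act B (switchedController K₁ K₀ M t (switchedLoop A B K₁ K₀ M t w k).1
          (switchedLoop A B K₁ K₀ M t w k).2).1 + w k := rfl
  rw [h, switchedController_fst, linearLoop_succ]
  split_ifs
  · simp only [add_act, act_sub, mul_act, sub_act]; abel
  · simp only [add_act, act_sub, mul_act]; abel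

lemma switchedLoop_sub_linearLoop_sq_le (hq0 : 0 ≤ q) (hq : q < 1)
    (h₁ : ∀ x, ‖act L (act (A + B * K₁) x)‖ ≤ q * ‖act L x‖) {β : ℝ}
    (hB : ∀ x, ‖act L (act (B * (K₁ - K₀)) x)‖ ≤ β * ‖act L x‖) (M : ℝ) (t : ℕ) (w : ℕ → Vec n)
    {f : ℕ → ℝ} (hf : ∀ k, fallbackSq A B K₁ K₀ M t L w k ≤ f k) (k : ℕ) :
    ‖act L ((switchedLoop A B K₁ K₀ M t w k).1 - linearLoop A B K₁ w k)‖ ^ 2 ≤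
      linRec q 0 (fun j => β ^ 2 / (1 - q) * f j) k := by
  refine le_linRec (f := fun k => ‖act L ((switchedLoop A B K₁ K₀ M t w k).1 -
    linearLoop A B K₁ w k)‖ ^ 2) hq0 ?_ (fun k => ?_) k
  · have h1 : (switchedLoop A B K₁ K₀ M t w 0).1 = 0 := rfl
    have h2 : linearLoop A B K₁ w 0 = 0 := rfl
    simp [h1, h2, act_zero]
  · have hq' : 0 < 1 - q := by linarith
    refine le_trans ?_ (add_le_add_right
      (mul_le_mul_of_nonneg_left (hf k) (by positivity : 0 ≤ β ^ 2 / (1 - q))) _)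
    simp only [switchedLoop_sub_linearLoop_succ, fallbackSq]
    split_ifs
    · have h := pow_le_pow_left₀ (norm_nonneg _) ((norm_sub_le
        (act L (act (A + B * K₁) ((switchedLoop A B K₁ K₀ M t w k).1 - linearLoop A B K₁ w k)))
        (act L (act (B * (K₁ - K₀)) (switchedLoop A B K₁ K₀ M t w k).1))).trans
        (add_le_add (h₁ _) (hB _))) 2
      rw [act_sub L]
      refine (h.trans (sq_add_le hq hq0)).trans_eq ?_
      ring
    · have h := pow_le_pow_left₀ (norm_nonneg _)
        (h₁ ((switchedLoop A B K₁ K₀ M t w k).1 - linearLoop A B K₁ w k)) 2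
      rw [sub_zero, mul_zero, add_zero]
      refine h.trans ?_
      rw [mul_pow]
      gcongr
      nlinarith

/-- Young's inequality with weight `δ` on the cross term. Later `‖u - v‖²` has mean `O(δ²)` and
`‖v‖²` has mean `O(1)`, so both contributions are of order `δ`. -/
lemma abs_quadForm_sub_le_of_pos (S : Matrix (Fin n) (Fin n) ℝ) {δ : ℝ} (hδ : 0 < δ) (hδ1 : δ ≤ 1)
    (u v : Vec n) : |quadForm S u - quadForm S v| ≤
      specNorm S * (2 * (δ⁻¹ * ‖u - v‖ ^ 2) + δ * ‖v‖ ^ 2) := by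
  refine (abs_quadForm_sub_le S u v).trans (mul_le_mul_of_nonneg_left ?_ (specNorm_nonneg S))
  have h1 : ‖u‖ ≤ ‖u - v‖ + ‖v‖ := by simpa using norm_add_le (u - v) v
  have h2 : ‖u - v‖ ^ 2 ≤ δ⁻¹ * ‖u - v‖ ^ 2 :=
    le_mul_of_one_le_left (by positivity) ((one_le_inv₀ hδ).2 hδ1)
  have h3 : 2 * ‖u - v‖ * ‖v‖ ≤ δ⁻¹ * ‖u - v‖ ^ 2 + δ * ‖v‖ ^ 2 := by
    have h4 : δ⁻¹ * ‖u - v‖ ^ 2 + δ * ‖v‖ ^ 2 - 2 * ‖u - v‖ * ‖v‖ =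
        δ⁻¹ * (‖u - v‖ - δ * ‖v‖) ^ 2 := by field_simp; ring
    have : 0 ≤ δ⁻¹ * (‖u - v‖ - δ * ‖v‖) ^ 2 := by positivity
    linarith
  have h5 := mul_le_mul_of_nonneg_left h1 (norm_nonneg (u - v))
  nlinarith

variable {p : ℝ}

lemma linear_stageCost_le (Q : Matrix (Fin n) (Fin n) ℝ) (R : Matrix (Fin m) (Fin m) ℝ)
    (hL : ∀ x : Vec n, ‖x‖ ^ 2 ≤ p * ‖act L x‖ ^ 2) (w : ℕ → Vec n) (k : ℕ) :
    stageCost A B Q R (linearController K₁) () w k ≤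
      (specNorm Q + specNorm R * specNorm K₁ ^ 2) * p * ‖act L (linearLoop A B K₁ w k)‖ ^ 2 := by
  have hR := specNorm_nonneg R
  have hQ := specNorm_nonneg Q
  change quadForm Q (linearLoop A B K₁ w k) + quadForm R (act K₁ (linearLoop A B K₁ w k)) ≤ _
  set y := linearLoop A B K₁ w k
  calc _ ≤ specNorm Q * ‖y‖ ^ 2 + specNorm R * (specNorm K₁ * ‖y‖) ^ 2 :=
        add_le_add (quadForm_le _ _) ((quadForm_le _ _).trans
          (by gcongr; exact norm_act_le _ _))
    _ = (specNorm Q + specNorm R * specNorm K₁ ^ 2) * ‖y‖ ^ 2 := by ring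
    _ ≤ (specNorm Q + specNorm R * specNorm K₁ ^ 2) * (p * ‖act L y‖ ^ 2) := by
        gcongr; exact hL y
    _ = _ := by ring

/-- Pathwise comparison of the stage costs of the switched and of the linear controller. -/
lemma abs_stageCost_sub_le (Q : Matrix (Fin n) (Fin n) ℝ) (R : Matrix (Fin m) (Fin m) ℝ)
    (hp : 0 ≤ p) (hL : ∀ x : Vec n, ‖x‖ ^ 2 ≤ p * ‖act L x‖ ^ 2) :
    ∃ C : ℝ, 0 ≤ C ∧ ∀ (M : ℝ) (t : ℕ) (w : ℕ → Vec n) (k : ℕ) (δ : ℝ), 0 < δ → δ ≤ 1 →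
      |stageCost A B Q R (switchedController K₁ K₀ M t) 0 w k -
        stageCost A B Q R (linearController K₁) () w k| ≤
      C * (δ⁻¹ * (‖act L ((switchedLoop A B K₁ K₀ M t w k).1 - linearLoop A B K₁ w k)‖ ^ 2 +
        fallbackSq A B K₁ K₀ M t L w k) + δ * ‖act L (linearLoop A B K₁ w k)‖ ^ 2) := by
  classical
  have hR := specNorm_nonneg R
  have hQ := specNorm_nonneg Q
  refine ⟨(2 * specNorm Q + 4 * specNorm R * (specNorm K₁ ^ 2 + specNorm (K₁ - K₀) ^ 2)) * p,
    by positivity, fun M t w k δ hδ hδ1 => ?_⟩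
  set x := (switchedLoop A B K₁ K₀ M t w k).1 with hx
  set y := linearLoop A B K₁ w k with hy
  set v := (switchedController K₁ K₀ M t (switchedLoop A B K₁ K₀ M t w k).1
          (switchedLoop A B K₁ K₀ M t w k).2).1 with hv
  change |quadForm Q x + quadForm R v - (quadForm Q y + quadForm R (act K₁ y))| ≤ _
  set I := fallbackSq A B K₁ K₀ M t L w k with hI
  have hI0 : 0 ≤ I := by rw [hI, fallbackSq]; split_ifs <;> positivity
  have hd := hL (x - y)
  have hyL := hL y
  -- The inputs differ by `K₁ (x - y)`, corrected by `(K₁ - K₀) x` on fallback steps.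
  have hu : ‖v - act K₁ y‖ ^ 2 ≤
      2 * (specNorm K₁ ^ 2 * ‖x - y‖ ^ 2) + 2 * (specNorm (K₁ - K₀) ^ 2 * (p * I)) := by
    rw [hv, switchedController_fst]
    rw [hI, fallbackSq]
    split_ifs with h
    · have e : act K₀ x - act K₁ y = act K₁ (x - y) - act (K₁ - K₀) x := by
        rw [act_sub, sub_act]; abel
      have h1 : ‖act K₀ x - act K₁ y‖ ≤ specNorm K₁ * ‖x - y‖ + specNorm (K₁ - K₀) * ‖x‖ := by
        rw [e]; exact (norm_sub_le _ _).trans (add_le_add (norm_act_le _ _) (norm_act_le _ _))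
      have h2 := pow_le_pow_left₀ (norm_nonneg _) h1 2
      have h3 := mul_le_mul_of_nonneg_left (hL x) (sq_nonneg (specNorm (K₁ - K₀)))
      nlinarith [sq_nonneg (specNorm K₁ * ‖x - y‖ - specNorm (K₁ - K₀) * ‖x‖)]
    · rw [← act_sub]
      have h2 := pow_le_pow_left₀ (norm_nonneg _) (norm_act_le K₁ (x - y)) 2
      rw [mul_pow] at h2
      have : 0 ≤ specNorm K₁ ^ 2 * ‖x - y‖ ^ 2 := by positivity
      simp only [mul_zero, add_zero]
      linarith
  have hKy : ‖act K₁ y‖ ^ 2 ≤ specNorm K₁ ^ 2 * ‖y‖ ^ 2 := by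
    rw [← mul_pow]; exact pow_le_pow_left₀ (norm_nonneg _) (norm_act_le _ _) 2
  have h1 := abs_quadForm_sub_le_of_pos Q hδ hδ1 x y
  have h2 := abs_quadForm_sub_le_of_pos R hδ hδ1 v (act K₁ y)
  have h3 : |quadForm Q x + quadForm R v - (quadForm Q y + quadForm R (act K₁ y))| ≤
      |quadForm Q x - quadForm Q y| + |quadForm R v - quadForm R (act K₁ y)| := by
    rw [add_sub_add_comm]; exact abs_add_le _ _
  have hδi : 0 < δ⁻¹ := inv_pos.2 hδ
  set D := ‖act L (x - y)‖ ^ 2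
  set Y := ‖act L y‖ ^ 2
  have hD0 : 0 ≤ D := by positivity
  have hY0 : 0 ≤ Y := by positivity
  calc _ ≤ specNorm Q * (2 * (δ⁻¹ * ‖x - y‖ ^ 2) + δ * ‖y‖ ^ 2) +
        specNorm R * (2 * (δ⁻¹ * ‖v - act K₁ y‖ ^ 2) + δ * ‖act K₁ y‖ ^ 2) :=
        h3.trans (add_le_add h1 h2)
    _ ≤ specNorm Q * (2 * (δ⁻¹ * (p * D)) + δ * (p * Y)) +
        specNorm R * (2 * (δ⁻¹ * (2 * (specNorm K₁ ^ 2 * (p * D)) +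
          2 * (specNorm (K₁ - K₀) ^ 2 * (p * I)))) + δ * (specNorm K₁ ^ 2 * (p * Y))) := by
        gcongr
        · exact hu.trans (by gcongr)
        · exact hKy.trans (by gcongr)
    _ ≤ _ := by
        have e1 : 0 ≤ specNorm Q * p * (δ⁻¹ * I) := by positivity
        have e2 : 0 ≤ specNorm Q * p * (δ * Y) := by positivity
        have e3 : 0 ≤ specNorm R * specNorm K₁ ^ 2 * p * (δ⁻¹ * I) := by positivity
        have e4 : 0 ≤ specNorm R * specNorm K₁ ^ 2 * p * (δ * Y) := by positivity
        have e5 : 0 ≤ specNorm R * specNorm (K₁ - K₀) ^ 2 * p * (δ⁻¹ * D) := by positivity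
        have e6 : 0 ≤ specNorm R * specNorm (K₁ - K₀) ^ 2 * p * (δ * Y) := by positivity
        linarith

end CostComparison

/-! ### Mean size of fallback steps and of the stage-cost gap. -/

section ExpectedGap

variable {n m : ℕ} {A : Matrix (Fin n) (Fin n) ℝ} {B : Matrix (Fin n) (Fin m) ℝ}
  {K₁ K₀ : Matrix (Fin m) (Fin n) ℝ} {L : Matrix (Fin n) (Fin n) ℝ} {q κ a ε c : ℝ}

/-- The recursion that dominates the exponential Lyapunov function along the renewal times. -/
noncomputable def renewalMajorant (F L : Matrix (Fin n) (Fin n) ℝ) (r c : ℝ) (t : ℕ)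
    (w : ℕ → Vec n) : ℕ → ℝ :=
  linRec r 1 (fun j => Real.exp (c * ‖act L (flightNoise F w j 1)‖ ^ 2) +
    Real.exp (c * ‖act L (flightNoise F w (j + 1 - t) t)‖ ^ 2))

lemma renewalMajorant_nonneg (F L : Matrix (Fin n) (Fin n) ℝ) {r : ℝ} (hr : 0 ≤ r) (c : ℝ) (t : ℕ)
    (w : ℕ → Vec n) (k : ℕ) : 0 ≤ renewalMajorant F L r c t w k :=
  linRec_nonneg hr zero_le_one (fun _ => add_nonneg (Real.exp_pos _).le (Real.exp_pos _).le) k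

/-- The delay since the trigger is random, so the bound sums over all delays `τ < t`. Every summand
sits at a deterministic time, so expectations can be taken without conditioning on the trigger. -/
lemma fallbackSq_le {M s r : ℝ} {t : ℕ} (hq0 : 0 ≤ q) (hq : q < 1) (hr0 : 0 ≤ r) (hqr : q ≤ r)
    (hqt : q ≤ r ^ t) (ht : 1 ≤ t) (hκ : 0 ≤ κ) (ha : 0 ≤ a) (hε : 0 < ε)
    (hc : a + ε = c * (1 - q) ^ 2) (hs : 0 ≤ s)
    (h₁ : ∀ x, ‖act L (act (A + B * K₁) x)‖ ≤ q * ‖act L x‖)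
    (h₀ : ∀ x, ‖act L (act ((A + B * K₀) ^ t) x)‖ ≤ q * ‖act L x‖)
    (hpow : ∀ τ x, ‖act L (act ((A + B * K₀) ^ τ) x)‖ ≤ κ * ‖act L x‖)
    (htrig : ∀ x, M ≤ ‖act (K₁ - K₀) x‖ → s ≤ ‖act L x‖) (w : ℕ → Vec n) (k : ℕ) :
    fallbackSq A B K₁ K₀ M t L w k ≤ (κ + (1 - q)) ^ 2 / ε * Real.exp (-(a * s ^ 2)) *
      ∑ τ ∈ Finset.range t, (renewalMajorant (A + B * K₀) L r c t w (k - τ) +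
        Real.exp (c * ‖act L (flightNoise (A + B * K₀) w (k - τ) τ)‖ ^ 2)) := by
  have hη : 0 < 1 - q := by linarith
  have hc0 : 0 ≤ c := by
    by_contra h
    have : c * (1 - q) ^ 2 ≤ 0 := mul_nonpos_of_nonpos_of_nonneg (not_le.1 h).le (sq_nonneg _)
    linarith
  have hterm : ∀ τ, 0 ≤ renewalMajorant (A + B * K₀) L r c t w (k - τ) +
        Real.exp (c * ‖act L (flightNoise (A + B * K₀) w (k - τ) τ)‖ ^ 2) := fun τ =>
    add_nonneg (renewalMajorant_nonneg _ _ hr0 _ _ _ _) (Real.exp_pos _).le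
  unfold fallbackSq
  split_ifs with hfb
  · obtain ⟨i, τ, hi, hτ, hi0, hiM, -, hx⟩ := exists_trigger_of_usesFallback hfb ht
    obtain rfl : i = k - τ := by omega
    have hG := exp_le_linRec hq0 hq hr0 hqr hqt hc0 ht h₁ h₀ _ hi0
    set xi := (switchedLoop A B K₁ K₀ M t w (k - τ)).1
    set S := flightNoise (A + B * K₀) w (k - τ) τ with hS
    have hN : ‖act L (switchedLoop A B K₁ K₀ M t w k).1‖ ≤ κ * ‖act L xi‖ + ‖act L S‖ := by
      rw [hx, act_add]
      exact (norm_add_le _ _).trans (by gcongr; exact hpow _ _)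
    have htail := sq_le_exp_tail hκ hη ha hε hs (htrig _ hiM) (norm_nonneg (act L S))
    -- The choice `η = 1 - q` gives the flight noise exactly the exponent `c` and the trigger state
    -- the exponent of the Lyapunov function.
    rw [show (a + ε) / (1 - q) ^ 2 = c by rw [hc]; field_simp, hc] at htail
    refine ((pow_le_pow_left₀ (norm_nonneg _) hN 2).trans htail).trans ?_
    gcongr
    refine le_trans ?_ (Finset.single_le_sum (fun τ _ => hterm τ) (Finset.mem_range.2 hτ))
    exact add_le_add hG le_rfl
  · exact mul_nonneg (by positivity) (Finset.sum_nonneg fun τ _ => hterm τ)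

variable {Ω : Type*} [MeasurableSpace Ω] {μ : Measure Ω} [IsProbabilityMeasure μ] {C₀ : ℝ}
  {w : ℕ → Ω → Vec n}

lemma meanLE_renewalMajorant {F : Matrix (Fin n) (Fin n) ℝ} {r : ℝ} (hr0 : 0 ≤ r) (hr1 : r < 1)
    (hC₀ : 0 ≤ C₀) (t : ℕ)
    (hsub : ∀ i τ, MeanLE μ
      (fun ω => Real.exp (c * ‖act L (flightNoise F (fun k => w k ω) i τ)‖ ^ 2)) C₀) (k : ℕ) :
    MeanLE μ (fun ω => renewalMajorant F L r c t (fun k => w k ω) k)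
      (1 + (C₀ + C₀) / (1 - r)) :=
  MeanLE.linRec hr0 hr1 (add_nonneg hC₀ hC₀)
    (fun j => (hsub j 1).add (hsub (j + 1 - t) t)) k zero_le_one

lemma norm_act_noise_sq_le (hc : 0 < c) (F : Matrix (Fin n) (Fin n) ℝ) (w : ℕ → Vec n) (k : ℕ) :
    ‖act L (w k)‖ ^ 2 ≤ c⁻¹ * Real.exp (c * ‖act L (flightNoise F w k 1)‖ ^ 2) := by
  have : flightNoise F w k 1 = w k := by simp [flightNoise, act_zero]
  rw [this, inv_mul_eq_div, le_div_iff₀ hc]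
  linarith [Real.add_one_le_exp (c * ‖act L (w k)‖ ^ 2)]

/-- The second moments of the primary loop are dominated uniformly in time. -/
lemma exists_linearLoop_majorant (hq0 : 0 ≤ q) (hq : q < 1) (hc : 0 < c) (hC₀ : 0 ≤ C₀)
    (h₁ : ∀ x, ‖act L (act (A + B * K₁) x)‖ ≤ q * ‖act L x‖)
    (hsub : ∀ i τ, MeanLE μ (fun ω => Real.exp
      (c * ‖act L (flightNoise (A + B * K₀) (fun k => w k ω) i τ)‖ ^ 2)) C₀) (k : ℕ) :
    ∃ Y : Ω → ℝ, MeanLE μ Y ((1 - q)⁻¹ * (c⁻¹ * C₀) / (1 - q)) ∧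
      ∀ ω, ‖act L (linearLoop A B K₁ (fun k => w k ω) k)‖ ^ 2 ≤ Y ω := by
  have hq' : 0 < 1 - q := by linarith
  refine ⟨_, ?_, fun ω => linearLoop_sq_le hq0 hq h₁ _ (norm_act_noise_sq_le hc (A + B * K₀) _) k⟩
  simpa using MeanLE.linRec hq0 hq (by positivity) (fun j =>
    ((hsub j 1).const_mul (inv_nonneg.2 hc.le)).const_mul (inv_nonneg.2 hq'.le)) k le_rfl

/-- The expected difference of the stage costs is dominated by a multiple of `t exp (-a s² / 2)`,
uniformly in time, if a trigger forces `|L x| ≥ s`. -/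
theorem exists_stageCost_gap_majorant (Q : Matrix (Fin n) (Fin n) ℝ)
    (R : Matrix (Fin m) (Fin m) ℝ) {p β : ℝ} (hq0 : 0 < q) (hq : q < 1) (hκ : 0 ≤ κ) (ha : 0 ≤ a)
    (hε : 0 < ε) (hc : a + ε = c * (1 - q) ^ 2) (hC₀ : 0 ≤ C₀) (hp : 0 ≤ p)
    (hL : ∀ x : Vec n, ‖x‖ ^ 2 ≤ p * ‖act L x‖ ^ 2)
    (h₁ : ∀ x, ‖act L (act (A + B * K₁) x)‖ ≤ q * ‖act L x‖)
    (hB : ∀ x, ‖act L (act (B * (K₁ - K₀)) x)‖ ≤ β * ‖act L x‖)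
    (hpow : ∀ τ x, ‖act L (act ((A + B * K₀) ^ τ) x)‖ ≤ κ * ‖act L x‖)
    (hsub : ∀ i τ, MeanLE μ (fun ω => Real.exp
      (c * ‖act L (flightNoise (A + B * K₀) (fun k => w k ω) i τ)‖ ^ 2)) C₀) :
    ∃ C : ℝ, 0 ≤ C ∧ ∀ (M s : ℝ) (t : ℕ) (δ : ℝ), 1 ≤ t → 0 ≤ s →
      (∀ x, ‖act L (act ((A + B * K₀) ^ t) x)‖ ≤ q * ‖act L x‖) →
      (∀ x, M ≤ ‖act (K₁ - K₀) x‖ → s ≤ ‖act L x‖) →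
      δ = t * Real.exp (-(a * s ^ 2) / 2) → δ ≤ 1 → ∀ k, ∃ H : Ω → ℝ, MeanLE μ H (C * δ) ∧
        ∀ ω, |stageCost A B Q R (switchedController K₁ K₀ M t) 0 (fun k => w k ω) k -
          stageCost A B Q R (linearController K₁) () (fun k => w k ω) k| ≤ H ω := by
  obtain ⟨C, hC, hcost⟩ := abs_stageCost_sub_le (A := A) (B := B) (K₁ := K₁) (K₀ := K₀) Q R hp hL
  have hq' : 0 < 1 - q := by linarith
  have hc0 : 0 < c := by
    by_contra h
    have : c * (1 - q) ^ 2 ≤ 0 := mul_nonpos_of_nonpos_of_nonneg (not_lt.1 h) (sq_nonneg _)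
    linarith
  set b := (κ + (1 - q)) ^ 2 / ε with hb
  have hb0 : 0 ≤ b := by positivity
  set D := b * (1 + (C₀ + C₀) / (1 - q) + C₀) with hD
  have hD0 : 0 ≤ D := by positivity
  set E := β ^ 2 / (1 - q) * D / (1 - q) + D with hE
  set V := (1 - q)⁻¹ * (c⁻¹ * C₀) / (1 - q) with hV
  refine ⟨C * (E + V), by positivity, fun M s t δ ht hs h₀ htrig hδ hδ1 k => ?_⟩
  have ht0 : (0 : ℝ) < t := by exact_mod_cast ht
  have ht1 : (1 : ℝ) ≤ t := by exact_mod_cast ht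
  have hδ0 : 0 < δ := by rw [hδ]; positivity
  have hδ2 : δ ^ 2 = t ^ 2 * Real.exp (-(a * s ^ 2)) := by
    rw [hδ, mul_pow, ← Real.exp_nat_mul]; congr 2; push_cast; ring
  -- Then `r ^ t = q` and `q ≤ r`: one ratio serves both kinds of renewal.
  set r := q ^ (1 / (t : ℝ)) with hr
  have hr0 : 0 < r := Real.rpow_pos_of_pos hq0 _
  have hrt : r ^ t = q := by
    rw [hr, ← Real.rpow_natCast, ← Real.rpow_mul hq0.le, one_div, inv_mul_cancel₀ ht0.ne',
      Real.rpow_one]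
  have hr1 : r < 1 := Real.rpow_lt_one hq0.le hq (by positivity)
  have hqr : q ≤ r := by
    rw [← hrt]
    exact pow_le_of_le_one hr0.le hr1.le (by omega)
  -- Bernoulli's inequality: the slow ratio costs only a factor `t` in the mean of the majorant.
  have hbern : 1 - q ≤ t * (1 - r) := by
    have := one_add_mul_le_pow (a := r - 1) (by linarith) t
    rw [add_sub_cancel, hrt] at this
    linarith
  have hr' : 0 < 1 - r := by linarith
  have hdiv : (C₀ + C₀) / (1 - r) ≤ t * ((C₀ + C₀) / (1 - q)) := by
    rw [div_le_iff₀ hr', mul_comm (t : ℝ), mul_assoc, div_mul_eq_mul_div, le_div_iff₀ hq']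
    gcongr
  let f : Ω → ℕ → ℝ := fun ω k => b * Real.exp (-(a * s ^ 2)) *
      ∑ τ ∈ Finset.range t,
        (renewalMajorant (A + B * K₀) L r c t (fun k => w k ω) (k - τ) +
        Real.exp (c * ‖act L (flightNoise (A + B * K₀) (fun k => w k ω) (k - τ) τ)‖ ^ 2))
  have hf : ∀ ω k, fallbackSq A B K₁ K₀ M t L (fun k => w k ω) k ≤ f ω k := fun ω k =>
    fallbackSq_le hq0.le hq hr0.le hqr hrt.ge ht hκ ha hε hc hs h₁ h₀ hpow htrig _ k
  -- One factor `t` comes from the sum over delays and one from the mean of the renewal majorant;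
  -- with the exponential tail they form `δ ^ 2`.
  have hfm : ∀ k, MeanLE μ (fun ω => f ω k) (D * δ ^ 2) := by
    intro k
    refine ((MeanLE.sum_range (fun τ => (meanLE_renewalMajorant hr0.le hr1 hC₀ t hsub (k - τ)).add
      (hsub (k - τ) τ)) t).const_mul (by positivity : 0 ≤ b * Real.exp (-(a * s ^ 2)))).mono ?_
    have h1 : 1 + (C₀ + C₀) / (1 - r) + C₀ ≤ t * (1 + (C₀ + C₀) / (1 - q) + C₀) := by nlinarith
    calc _ ≤ b * Real.exp (-(a * s ^ 2)) * (t * (t * (1 + (C₀ + C₀) / (1 - q) + C₀))) := by gcongr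
      _ = _ := by rw [hδ2, hD]; ring
  obtain ⟨Y, hYm, hY⟩ := exists_linearLoop_majorant hq0.le hq hc0 hC₀ h₁ hsub k
  have hdm : MeanLE μ (fun ω => linRec q 0 (fun j => β ^ 2 / (1 - q) * f ω j) k)
      (β ^ 2 / (1 - q) * (D * δ ^ 2) / (1 - q)) := by
    simpa using MeanLE.linRec hq0.le hq (by positivity)
      (fun j => (hfm j).const_mul (by positivity : 0 ≤ β ^ 2 / (1 - q))) k le_rfl
  refine ⟨_, ((((hdm.add (hfm k)).const_mul (inv_nonneg.2 hδ0.le)).add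
    (hYm.const_mul hδ0.le)).const_mul hC).mono (le_of_eq ?_), fun ω => ?_⟩
  · rw [hE, hV]; field_simp
  · refine (hcost M t _ k δ hδ0 hδ1).trans ?_
    have h1 := switchedLoop_sub_linearLoop_sq_le hq0.le hq h₁ hB M t (fun k => w k ω) (hf ω) k
    have h2 := hf ω k
    have h3 := hY ω
    have h4 : 0 ≤ δ⁻¹ := inv_nonneg.2 hδ0.le
    gcongr

end ExpectedGap

/-! ### From stage costs to long-run averages. -/

section AverageCost

variable {Ω : Type*} [MeasurableSpace Ω] {μ : Measure Ω}

/-- Only the majorant `H` has to be measurable to split the lower integral, so nothing is needed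
about measurability of the costs `f` and `g`. -/
lemma limsup_average_le_add {f g : ℕ → Ω → ℝ} {D : ℝ}
    (h : ∀ k, ∃ H : Ω → ℝ, MeanLE μ H D ∧ (∀ ω, 0 ≤ H ω) ∧ ∀ ω, f k ω ≤ g k ω + H ω) :
    limsup (fun T : ℕ => (∫⁻ ω, ENNReal.ofReal (∑ k ∈ Finset.range T, f k ω) ∂μ) / (T : ℝ≥0∞))
      atTop ≤
    limsup (fun T : ℕ => (∫⁻ ω, ENNReal.ofReal (∑ k ∈ Finset.range T, g k ω) ∂μ) / (T : ℝ≥0∞))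
      atTop + ENNReal.ofReal D := by
  choose H hH hH0 hle using h
  rw [← limsup_add_const atTop _ _ (by isBoundedDefault) (by isBoundedDefault)]
  refine limsup_le_limsup ?_ (by isBoundedDefault) (by isBoundedDefault)
  filter_upwards [eventually_ge_atTop 1] with T hT
  have hT0 : (T : ℝ≥0∞) ≠ 0 := by exact_mod_cast (by omega : T ≠ 0)
  have hm := MeanLE.sum_range hH T
  have h1 : ∫⁻ ω, ENNReal.ofReal (∑ k ∈ Finset.range T, f k ω) ∂μ ≤
      ∫⁻ ω, ENNReal.ofReal (∑ k ∈ Finset.range T, g k ω) ∂μ + T * ENNReal.ofReal D := by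
    calc _ ≤ ∫⁻ ω, (ENNReal.ofReal (∑ k ∈ Finset.range T, g k ω) +
          ENNReal.ofReal (∑ k ∈ Finset.range T, H k ω)) ∂μ := by
          refine lintegral_mono fun ω => ?_
          refine (ENNReal.ofReal_le_ofReal ?_).trans ENNReal.ofReal_add_le
          rw [← Finset.sum_add_distrib]
          exact Finset.sum_le_sum fun k _ => hle k ω
      _ = _ := lintegral_add_right' _ hm.1.aestronglyMeasurable.aemeasurable.ennreal_ofReal
      _ ≤ _ := by
          gcongr
          rw [← ofReal_integral_eq_lintegral_ofReal hm.1
            (ae_of_all _ fun ω => Finset.sum_nonneg fun k _ => hH0 k ω)]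
          refine (ENNReal.ofReal_le_ofReal hm.2).trans_eq ?_
          rw [ENNReal.ofReal_mul (by positivity), ENNReal.ofReal_natCast]
  calc _ ≤ (∫⁻ ω, ENNReal.ofReal (∑ k ∈ Finset.range T, g k ω) ∂μ + T * ENNReal.ofReal D) / T := by
        gcongr
    _ = _ := by
        rw [ENNReal.add_div, mul_comm (T : ℝ≥0∞),
          ENNReal.mul_div_cancel_right hT0 (ENNReal.natCast_ne_top T)]

end AverageCost

/-! ### Choice of constants and the quantitative gap bound. -/

section GapBound

variable {n m : ℕ}

lemma norm_le_norm_act_factor {P L : Matrix (Fin n) (Fin n) ℝ} (h : P = Lᵀ * L) (hL : IsUnit L)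
    (x : Vec n) : ‖x‖ ≤ √(specNorm P⁻¹) * ‖act L x‖ := by
  refine le_of_sq_le_sq ?_ (by positivity)
  rw [mul_pow, Real.sq_sqrt (specNorm_nonneg _)]
  exact norm_sq_le_norm_act_factor h hL _

lemma norm_act_factor_act_le {P L : Matrix (Fin n) (Fin n) ℝ} (h : P = Lᵀ * L) (hL : IsUnit L)
    (X : Matrix (Fin n) (Fin n) ℝ) (x : Vec n) :
    ‖act L (act X x)‖ ≤ √(specNorm P) * √(specNorm P⁻¹) * specNorm X * ‖act L x‖ := by
  have hP := specNorm_nonneg P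
  have hP' := specNorm_nonneg P⁻¹
  have hX := specNorm_nonneg X
  have h1 : ‖act L (act X x)‖ ≤ √(specNorm P) * ‖act X x‖ := by
    refine le_of_sq_le_sq ?_ (by positivity)
    rw [mul_pow, Real.sq_sqrt hP]
    exact norm_act_factor_sq_le h _
  have h2 := norm_le_norm_act_factor h hL x
  calc _ ≤ √(specNorm P) * (specNorm X * (√(specNorm P⁻¹) * ‖act L x‖)) := by
        refine h1.trans ?_
        gcongr
        exact (norm_act_le _ _).trans (by gcongr)
    _ = _ := by ring

variable {Ω : Type*} [MeasurableSpace Ω] {μ : Measure Ω} [IsProbabilityMeasure μ]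

lemma meanLE_exp_flightNoise {F W P L : Matrix (Fin n) (Fin n) ℝ} (hF : IsStable F)
    (hW : W.PosSemidef) {w : ℕ → Ω → Vec n} (hw_indep : iIndepFun w μ)
    (hw_law : ∀ k, HasLaw (w k) (multivariateGaussian 0 W) μ) (hPL : P = Lᵀ * L) {c : ℝ}
    (hc : 0 ≤ c) (hcb : c * specNorm P * specNorm (noiseGramian F W) < 1 / 2) (i τ : ℕ) :
    MeanLE μ (fun ω => Real.exp (c * ‖act L (flightNoise F (fun k => w k ω) i τ)‖ ^ 2))
      (gaussianSqMoment n (c * specNorm P * specNorm (noiseGramian F W))) := by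
  have hmeas := aemeasurable_flightNoise F (fun k => (hw_law k).aemeasurable) i τ
  obtain ⟨h1, h2⟩ := integrable_exp_mul_norm_sq hmeas (mul_nonneg hc (specNorm_nonneg P)) hcb
    (mgf_inner_flightNoise_le hF hW hw_indep hw_law i τ)
  have hle : ∀ ω, Real.exp (c * ‖act L (flightNoise F (fun k => w k ω) i τ)‖ ^ 2) ≤
      Real.exp (c * specNorm P * ‖flightNoise F (fun k => w k ω) i τ‖ ^ 2) := fun ω => by
    rw [mul_assoc]
    gcongr
    exact norm_act_factor_sq_le hPL _
  have hm : AEMeasurable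
      (fun ω => Real.exp (c * ‖act L (flightNoise F (fun k => w k ω) i τ)‖ ^ 2)) μ := by
    have := (measurable_act L).comp_aemeasurable hmeas
    exact ((this.norm.pow_const 2).const_mul c).exp
  have hint := h1.mono' hm.aestronglyMeasurable (ae_of_all _ fun ω => by
    rw [Real.norm_of_nonneg (Real.exp_pos _).le]; exact hle ω)
  exact ⟨hint, (integral_mono hint h1 hle).trans h2⟩

lemma gapRate_nonneg (c M : ℝ) (t : ℕ) : 0 ≤ gapRate c M t := by
  unfold gapRate; positivity

/-- The fourth power is the quantity `δ` that the stage-cost estimate produces. -/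
lemma gapRate_pow_four (c M : ℝ) (t : ℕ) :
    gapRate c M t ^ 4 = t * Real.exp (-(4 * c * M ^ 2)) := by
  rw [gapRate, mul_pow, ← Real.rpow_natCast, ← Real.rpow_mul (by positivity), ← Real.exp_nat_mul]
  norm_num [mul_assoc]

/-- The cost of the primary gain is finite, and so is that of the switched controller, with a gap
of order `t^{1/4} exp (-c M²)`, as soon as `t` is large and that rate is at most `1`. -/
theorem exists_costGap_bound (A : Matrix (Fin n) (Fin n) ℝ) (B : Matrix (Fin n) (Fin m) ℝ)
    (Q : Matrix (Fin n) (Fin n) ℝ) (R : Matrix (Fin m) (Fin m) ℝ)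
    {W : Matrix (Fin n) (Fin n) ℝ} (hW : W.PosDef) {w : ℕ → Ω → Vec n} (hw_indep : iIndepFun w μ)
    (hw_law : ∀ k, HasLaw (w k) (multivariateGaussian 0 W) μ)
    {K₁ K₀ : Matrix (Fin m) (Fin n) ℝ} (hK : K₁ ≠ K₀) (hK₀ : IsStable (A + B * K₀))
    {ρ : ℝ} (hρ₀ : 0 < ρ) (hρ₁ : ρ < 1) {P : Matrix (Fin n) (Fin n) ℝ} (hP : P.PosDef)
    (hLyap : LoewnerLT ((A + B * K₁)ᵀ * P * (A + B * K₁)) (ρ • P)) :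
    0 < decayConst A B W K₁ K₀ ρ P ∧ linearCost μ A B Q R K₁ w ≠ ∞ ∧
    ∃ (C : ℝ) (t₀ : ℕ), ∀ (M : ℝ) (t : ℕ), 0 ≤ M → t₀ ≤ t →
      gapRate (decayConst A B W K₁ K₀ ρ P) M t ≤ 1 →
      switchedCost μ A B Q R K₁ K₀ M t w ≠ ∞ ∧
      |costGap μ A B Q R K₁ K₀ M t w| ≤ C * gapRate (decayConst A B W K₁ K₀ ρ P) M t := by
  have hn : 0 < n := by
    rcases Nat.eq_zero_or_pos n with rfl | h
    · exact absurd (Subsingleton.elim (α := Matrix (Fin m) (Fin 0) ℝ) K₁ K₀) hK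
    · exact h
  have : Nonempty (Fin n) := ⟨⟨0, hn⟩⟩
  set G := specNorm (noiseGramian (A + B * K₀) W) with hG
  have hG0 : 0 < G := specNorm_noiseGramian_pos hK₀ hW hn
  have hP0 : 0 < specNorm P := specNorm_pos hP.isUnit.ne_zero
  have hPi0 : 0 < specNorm P⁻¹ := specNorm_pos hP.inv.isUnit.ne_zero
  have hK0 : 0 < specNorm (K₁ - K₀) := specNorm_pos (sub_ne_zero.2 hK)
  set h := ρ ^ (1 / 4 : ℝ) with hh
  have hh0 : 0 < h := Real.rpow_pos_of_pos hρ₀ _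
  have hh1 : h < 1 := Real.rpow_lt_one hρ₀.le hρ₁ (by norm_num)
  have hh4 : (h ^ 2) ^ 2 = ρ := by
    rw [← pow_mul, hh, ← Real.rpow_natCast, ← Real.rpow_mul hρ₀.le]; norm_num
  have hq0 : 0 < h ^ 2 := by positivity
  have hq1 : h ^ 2 < 1 := by nlinarith
  have h1h : 0 < 1 - h := by linarith
  set d := decayConst A B W K₁ K₀ ρ P with hd
  have hd_eq : d = (1 - h) ^ 2 / (16 * G * specNorm P * specNorm P⁻¹ * specNorm (K₁ - K₀) ^ 2) :=
    rfl
  have hd0 : 0 < d := by rw [hd_eq]; positivity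
  obtain ⟨L, hPL, hL⟩ := exists_transpose_mul_self hP
  have h₁ : ∀ x, ‖act L (act (A + B * K₁) x)‖ ≤ h ^ 2 * ‖act L x‖ := fun x => by
    refine le_of_sq_le_sq ?_ (by positivity)
    have := quadForm_le_of_loewnerLT hLyap x
    rw [quadForm_conj, hPL, quadForm_transpose_mul] at this
    rw [mul_pow, hh4, ← quadForm_transpose_mul L x]
    refine this.trans_eq ?_
    simp [quadForm, Matrix.smul_mulVec]
  obtain ⟨Cs, r, hCs, hr0, hr1, hpow⟩ := hK₀.exists_specNorm_pow_le
  set p := √(specNorm P) * √(specNorm P⁻¹) with hp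
  have hFpow : ∀ τ x, ‖act L (act ((A + B * K₀) ^ τ) x)‖ ≤ p * Cs * r ^ τ * ‖act L x‖ :=
    fun τ x => (norm_act_factor_act_le hPL hL _ x).trans (by
      calc _ ≤ p * (Cs * r ^ τ) * ‖act L x‖ := by gcongr; exact hpow τ
        _ = _ := by ring)
  have hFpow' : ∀ τ x, ‖act L (act ((A + B * K₀) ^ τ) x)‖ ≤ p * Cs * ‖act L x‖ :=
    fun τ x => (hFpow τ x).trans (by
      exact mul_le_mul_of_nonneg_right (mul_le_of_le_one_right (by positivity)
        (pow_le_one₀ hr0 hr1.le)) (norm_nonneg _))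
  have hlim : Tendsto (fun τ : ℕ => p * Cs * r ^ τ) atTop (𝓝 0) := by
    simpa using (tendsto_pow_atTop_nhds_zero_of_lt_one hr0 hr1).const_mul (p * Cs)
  -- Beyond `t₀`, geometric decay beats the conditioning of `L`, so a fallback block contracts by `h
  -- ^ 2 = √ρ` like a primary step.
  obtain ⟨t₀, ht₀⟩ := eventually_atTop.1 (hlim.eventually_le_const hq0)
  -- The factor `1 + h > 1` keeps the noise exponent below the critical value `1 / 2`. Since `1 - h
  -- ^ 2 = (1 - h) (1 + h)`, it also splits `c (1 - h ^ 2) ^ 2` into the tail exponent `a` and a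
  -- positive margin `h a`.
  set c := 1 / (2 * (1 + h) * G * specNorm P) with hc
  set a := (1 - h) ^ 2 / (2 * G * specNorm P) with ha
  have hc0 : 0 < c := by positivity
  have ha0 : 0 < a := by positivity
  have hcb : c * specNorm P * G < 1 / 2 := by
    have : c * specNorm P * G = 1 / (2 * (1 + h)) := by rw [hc]; field_simp
    rw [this, one_div_lt_one_div (by positivity) (by norm_num)]
    linarith
  have hac : a + h * a = c * (1 - h ^ 2) ^ 2 := by
    rw [hc, ha]; field_simp; ring
  have hsub := meanLE_exp_flightNoise hK₀ hW.posSemidef hw_indep hw_law hPL hc0.le hcb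
  set C₀ := gaussianSqMoment n (c * specNorm P * G) with hC₀
  have hC₀0 : 0 ≤ C₀ :=
    integral_nonneg fun g => Finset.prod_nonneg fun i _ => (Real.exp_pos _).le
  have hLn := norm_sq_le_norm_act_factor hPL hL
  obtain ⟨C, hC, hgap⟩ := exists_stageCost_gap_majorant (μ := μ) (w := w) (A := A) (B := B)
    (K₁ := K₁) (K₀ := K₀) Q R hq0 hq1 (by positivity : 0 ≤ p * Cs) ha0.le (mul_pos hh0 ha0) hac
    hC₀0 hPi0.le hLn h₁ (norm_act_factor_act_le hPL hL _) hFpow' hsub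
  have hlin : linearCost μ A B Q R K₁ w ≠ ∞ := by
    set b := (specNorm Q + specNorm R * specNorm K₁ ^ 2) * specNorm P⁻¹
    have hb : 0 ≤ b := by
      have := specNorm_nonneg Q; have := specNorm_nonneg R; positivity
    have hle := limsup_average_le_add (μ := μ) (g := fun _ _ => 0)
      (f := fun k ω => stageCost A B Q R (linearController K₁) () (fun i => w i ω) k)
      (D := b * ((1 - h ^ 2)⁻¹ * (c⁻¹ * C₀) / (1 - h ^ 2))) (fun k => by
        obtain ⟨Y, hY, hYle⟩ := exists_linearLoop_majorant hq0.le hq1 hc0 hC₀0 h₁ hsub k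
        refine ⟨_, hY.const_mul hb, fun ω => mul_nonneg hb ((sq_nonneg _).trans (hYle ω)),
          fun ω => ?_⟩
        rw [zero_add]
        exact (linear_stageCost_le Q R hLn _ k).trans
          (mul_le_mul_of_nonneg_left (hYle ω) hb))
    refine ne_top_of_le_ne_top ?_ hle
    simp
  refine ⟨hd0, hlin, C, max t₀ 1, fun M t hM ht hrate => ?_⟩
  set g := gapRate d M t with hg
  have hg0 : 0 ≤ g := gapRate_nonneg _ _ _
  -- A trigger forces `‖L x‖ ≥ M / σ`, which is the threshold `s` of the tail estimate.
  set σ := √(specNorm P⁻¹) * specNorm (K₁ - K₀) with hσ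
  have hσ0 : 0 < σ := by positivity
  have hδ : g ^ 4 = t * Real.exp (-(a * (M / σ) ^ 2) / 2) := by
    rw [hg, gapRate_pow_four]
    congr 2
    rw [hd_eq, ha, hσ, div_pow, mul_pow, Real.sq_sqrt hPi0.le]
    field_simp
    ring
  have hbound : ∀ k, ∃ H : Ω → ℝ, MeanLE μ H (C * g ^ 4) ∧ ∀ ω,
      |stageCost A B Q R (switchedController K₁ K₀ M t) 0 (fun k => w k ω) k -
          stageCost A B Q R (linearController K₁) () (fun k => w k ω) k| ≤ H ω := by
    refine hgap M (M / σ) t (g ^ 4) ((le_max_right _ _).trans ht) (by positivity) (fun x => ?_)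
      (fun x hx => ?_) hδ (pow_le_one₀ hg0 hrate)
    · exact (hFpow t x).trans (by
        gcongr; exact ht₀ t ((le_max_left _ _).trans ht))
    · rw [div_le_iff₀ hσ0]
      have h2 := norm_le_norm_act_factor hPL hL x
      calc M ≤ specNorm (K₁ - K₀) * ‖x‖ := hx.trans (norm_act_le _ _)
        _ ≤ specNorm (K₁ - K₀) * (√(specNorm P⁻¹) * ‖act L x‖) := by gcongr
        _ = _ := by rw [hσ]; ring
  have hle₁ : switchedCost μ A B Q R K₁ K₀ M t w ≤
      linearCost μ A B Q R K₁ w + ENNReal.ofReal (C * g ^ 4) :=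
    limsup_average_le_add fun k => by
      obtain ⟨H, hH, hle⟩ := hbound k
      exact ⟨H, hH, fun ω => (abs_nonneg _).trans (hle ω), fun ω => by
        linarith [le_abs_self (stageCost A B Q R (switchedController K₁ K₀ M t) 0
          (fun k => w k ω) k - stageCost A B Q R (linearController K₁) () (fun k => w k ω) k),
          hle ω]⟩
  have hle₂ : linearCost μ A B Q R K₁ w ≤
      switchedCost μ A B Q R K₁ K₀ M t w + ENNReal.ofReal (C * g ^ 4) :=
    limsup_average_le_add fun k => by
      obtain ⟨H, hH, hle⟩ := hbound k
      exact ⟨H, hH, fun ω => (abs_nonneg _).trans (hle ω), fun ω => by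
        linarith [neg_abs_le (stageCost A B Q R (switchedController K₁ K₀ M t) 0
          (fun k => w k ω) k - stageCost A B Q R (linearController K₁) () (fun k => w k ω) k),
          hle ω]⟩
  have hsw : switchedCost μ A B Q R K₁ K₀ M t w ≠ ∞ :=
    ne_top_of_le_ne_top (ENNReal.add_ne_top.2 ⟨hlin, ENNReal.ofReal_ne_top⟩) hle₁
  refine ⟨hsw, ?_⟩
  have hD : 0 ≤ C * g ^ 4 := by positivity
  -- The estimate obtained is of order `g ^ 4`; `g ≤ 1` weakens it to the stated rate.
  have h4 : C * g ^ 4 ≤ C * g := by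
    gcongr; exact pow_le_of_le_one hg0 hrate (by norm_num)
  have e₁ := ENNReal.toReal_mono (ENNReal.add_ne_top.2 ⟨hlin, ENNReal.ofReal_ne_top⟩) hle₁
  have e₂ := ENNReal.toReal_mono (ENNReal.add_ne_top.2 ⟨hsw, ENNReal.ofReal_ne_top⟩) hle₂
  rw [ENNReal.toReal_add hlin ENNReal.ofReal_ne_top, ENNReal.toReal_ofReal hD] at e₁
  rw [ENNReal.toReal_add hsw ENNReal.ofReal_ne_top, ENNReal.toReal_ofReal hD] at e₂
  rw [costGap, abs_le]
  constructor <;> linarith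

end GapBound

/-! ### The limit regime and super-exponential decay. -/

section Regime

lemma eventually_gapRegime (c : ℝ) (t₀ : ℕ) :
    ∀ᶠ p in gapRegime c, 0 ≤ p.1 ∧ t₀ ≤ p.2 ∧ gapRate c p.1 p.2 ≤ 1 := by
  have h1 : ∀ᶠ p : ℝ × ℕ in gapRegime c, 0 ≤ p.1 ∧ t₀ ≤ p.2 :=
    ((eventually_ge_atTop (0 : ℝ)).prod_mk (eventually_ge_atTop t₀)).filter_mono inf_le_left
  have h2 : Tendsto (fun p : ℝ × ℕ => gapRate c p.1 p.2) (gapRegime c) (𝓝 0) :=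
    tendsto_comap.mono_left inf_le_right
  filter_upwards [h1, h2.eventually_le_const one_pos] with p hp hp'
  exact ⟨hp.1, hp.2, hp'⟩

lemma gapRate_isLittleO {c : ℝ} (hc : 0 < c) {t : ℝ → ℕ} (ht : Tendsto t atTop atTop)
    (hlog : (fun M : ℝ => Real.log (t M)) =o[atTop] (fun M : ℝ => M ^ 2)) (b : ℝ) :
    (fun M : ℝ => gapRate c M (t M)) =o[atTop] (fun M : ℝ => Real.exp (-b * M)) := by
  have h1 : (fun M : ℝ => Real.exp (-(c / 2) * M ^ 2)) =o[atTop]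
      (fun M : ℝ => Real.exp (-b * M)) := by
    rw [Real.isLittleO_exp_comp_exp_comp]
    have h2 : Tendsto (fun M : ℝ => M * (c / 2 * M + -b)) atTop atTop :=
      tendsto_id.atTop_mul_atTop₀
        (tendsto_atTop_add_const_right _ _ (tendsto_id.const_mul_atTop (by positivity)))
    refine h2.congr fun M => ?_
    ring
  refine IsBigO.trans_isLittleO (IsBigO.of_bound 1 ?_) h1
  -- With `log t ≤ 2 c M²`, the factor `t^{1/4}` uses up at most half of the exponent `c M²`.
  filter_upwards [hlog.bound (by positivity : 0 < 2 * c), ht.eventually_ge_atTop 1] with M hM ht1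
  have ht0 : (0 : ℝ) < t M := by exact_mod_cast ht1
  rw [Real.norm_of_nonneg (gapRate_nonneg _ _ _), Real.norm_of_nonneg (Real.exp_pos _).le, one_mul,
    gapRate, Real.rpow_def_of_pos ht0, ← Real.exp_add, Real.exp_le_exp]
  rw [Real.norm_of_nonneg (sq_nonneg M)] at hM
  have := (le_abs_self _).trans hM
  linarith

lemma tendsto_gapRegime {c : ℝ} (hc : 0 < c) {t : ℝ → ℕ} (ht : Tendsto t atTop atTop)
    (hlog : (fun M : ℝ => Real.log (t M)) =o[atTop] (fun M : ℝ => M ^ 2)) :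
    Tendsto (fun M : ℝ => (M, t M)) atTop (gapRegime c) := by
  refine tendsto_inf.2 ⟨tendsto_id.prodMk ht, tendsto_comap_iff.2 ?_⟩
  -- The case `b = 0` says that the rate tends to zero, which is the remaining condition of the
  -- regime.
  have h := gapRate_isLittleO hc ht hlog 0
  simp only [neg_zero, zero_mul, Real.exp_zero] at h
  exact (isLittleO_one_iff ℝ).1 h

end Regime

end SwitchedLQR

/-! ### The main theorem. -/

open SwitchedLQR in
theorem corollary1 {Ω : Type*} [MeasurableSpace Ω] (μ : Measure Ω) [IsProbabilityMeasure μ]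
    {n m : ℕ}
    (A : Matrix (Fin n) (Fin n) ℝ) (B : Matrix (Fin n) (Fin m) ℝ)
    (Q : Matrix (Fin n) (Fin n) ℝ) (R : Matrix (Fin m) (Fin m) ℝ)
    (W : Matrix (Fin n) (Fin n) ℝ)
    (hQ : Q.PosDef) (hR : R.PosDef) (hW : W.PosDef)
    -- the noise is i.i.d. with law `N(0, W)`
    (w : ℕ → Ω → Vec n)
    (hw_indep : iIndepFun w μ)
    (hw_law : ∀ k, HasLaw (w k) (multivariateGaussian 0 W) μ)
    -- both gains are stabilizing
    (K₁ K₀ : Matrix (Fin m) (Fin n) ℝ) (hK : K₁ ≠ K₀)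
    (hK₀ : IsStable (A + B * K₀)) (hK₁ : IsStable (A + B * K₁))
    -- `ρ, P` define a quadratic Lyapunov function for the primary closed loop; the same `P`
    -- automatically works for `(A + B K₀)^t` once `t` is large
    (ρ : ℝ) (hρ₀ : 0 < ρ) (hρ₁ : ρ < 1)
    (P : Matrix (Fin n) (Fin n) ℝ) (hP : P.PosDef)
    (hLyap : LoewnerLT ((A + B * K₁)ᵀ * P * (A + B * K₁)) (ρ • P)) :
    -- the costs are finite, so that their difference makes sense
    linearCost μ A B Q R K₁ w ≠ ∞ ∧
    (∀ᶠ p in gapRegime (decayConst A B W K₁ K₀ ρ P),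
      switchedCost μ A B Q R K₁ K₀ p.1 p.2 w ≠ ∞) ∧
    -- the rate
    (fun p : ℝ × ℕ => costGap μ A B Q R K₁ K₀ p.1 p.2 w)
      =O[gapRegime (decayConst A B W K₁ K₀ ρ P)]
      (fun p : ℝ × ℕ => gapRate (decayConst A B W K₁ K₀ ρ P) p.1 p.2) ∧
    -- super-exponential decay in `M`, for dwell times `t = t(M) → ∞` with `log t(M) = o(M²)`
    (∀ t : ℝ → ℕ, Tendsto t atTop atTop →
      (fun M : ℝ => Real.log (t M)) =o[atTop] (fun M : ℝ => M ^ 2) →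
      ∀ b : ℝ, (fun M : ℝ => costGap μ A B Q R K₁ K₀ M (t M) w)
        =o[atTop] (fun M : ℝ => Real.exp (-b * M))) := by
  obtain ⟨hd, hlin, C, t₀, hgap⟩ :=
    exists_costGap_bound A B Q R hW hw_indep hw_law hK hK₀ hρ₀ hρ₁ hP hLyap
  have hbig : (fun p : ℝ × ℕ => costGap μ A B Q R K₁ K₀ p.1 p.2 w)
      =O[gapRegime (decayConst A B W K₁ K₀ ρ P)]
      (fun p : ℝ × ℕ => gapRate (decayConst A B W K₁ K₀ ρ P) p.1 p.2) := by
    refine IsBigO.of_bound C ?_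
    filter_upwards [eventually_gapRegime _ t₀] with p hp
    rw [Real.norm_of_nonneg (gapRate_nonneg _ _ _)]
    exact (hgap p.1 p.2 hp.1 hp.2.1 hp.2.2).2
  refine ⟨hlin, ?_, hbig, fun t ht hlog b => ?_⟩
  · filter_upwards [eventually_gapRegime _ t₀] with p hp
    exact (hgap p.1 p.2 hp.1 hp.2.1 hp.2.2).1
  · exact (hbig.comp_tendsto (tendsto_gapRegime hd ht hlog)).trans_isLittleO
      (gapRate_isLittleO hd ht hlog b)
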